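/- Let $g,n\ge 0$ be integers and let $S_{g,n}$ be the surface obtained from a closed connected orientable surface of genus $g$ by removing $n$ points (the punctures); its Euler characteristic is $\chi(S_{g,n})=2-2g-n$. For simple closed curves $\alpha,\beta$ in $S_{g,n}$, let the geometric intersection number $i(\alpha,\beta)$ be the minimum of $|\alpha'\cap\beta'|$ over all simple closed curves $\alpha',\beta'$ in $S_{g,n}$ freely homotopic to $\alpha,\beta$ respectively. Say that $\alpha$ and $\beta$ fill $S_{g,n}$ if there are such representatives $\alpha',\beta'$ with $|\alpha'\cap\beta'|=i(\alpha,\beta)$ for which every connected component of $S_{g,n}\setminus(\alpha'\cup\beta')$ is an open disc or an open disc punctured once, at one of the punctures of $S_{g,n}$. If $\alpha$ and $\beta$ fill $S_{g,n}$, then $$i(\alpha,\beta)\ \ge\ -\chi(S_{g,n})=2g-2+n.$$ -/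

import Mathlib

namespace FillingCurves

/-- The polynomial that is positive exactly on the open disc of radius `3g + 1` about the origin
with `g` disjoint closed unit discs (centred at `(3k, 0)`, `k < g`) removed, zero on the `g + 1`
boundary circles, and negative elsewhere. -/
def holedDiscPoly (g : ℕ) (x y : ℝ) : ℝ :=
  ((3 * (g : ℝ) + 1) ^ 2 - x ^ 2 - y ^ 2) *
    ∏ k ∈ Finset.range g, ((x - 3 * (k : ℝ)) ^ 2 + y ^ 2 - 1)

/-- The standard closed orientable surface of genus `g` in `ℝ³`: the surface `z² = F(x, y)`, which
consists of two copies of a closed disc with `g` open holes, glued along their `g + 1` boundary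
circles. For `g = 0` it is the unit sphere, for `g = 1` the torus
`z² = (16 - x² - y²)(x² + y² - 1)`. -/
def StandardSurface (g : ℕ) : Type :=
  {p : ℝ × ℝ × ℝ // p.2.2 ^ 2 = holedDiscPoly g p.1 p.2.1}

instance (g : ℕ) : TopologicalSpace (StandardSurface g) :=
  inferInstanceAs (TopologicalSpace {p : ℝ × ℝ × ℝ // p.2.2 ^ 2 = holedDiscPoly g p.1 p.2.1})

/-- `X` is a closed (connected, orientable) surface of genus `g`. -/
def IsClosedSurfaceOfGenus (g : ℕ) (X : Type*) [TopologicalSpace X] : Prop :=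
  Nonempty (X ≃ₜ StandardSurface g)

/-- The surface `X` punctured at the points of the finite set `P`. If `X` is a closed surface of
genus `g` and `P` has `n` points, this is a surface of type `S_{g,n}`. -/
abbrev Punctured {X : Type*} (P : Finset X) : Type _ := {x : X // x ∉ P}

/-- The Euler characteristic `2 - 2g - n` of the surface of genus `g` with `n` punctures. -/
def eulerChar (g n : ℕ) : ℤ := 2 - 2 * (g : ℤ) - (n : ℤ)

/-- A simple closed curve in `S`: an injective continuous map from the circle. -/
structure SimpleClosedCurve (S : Type*) [TopologicalSpace S] where
  /-- the parametrization -/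
  map : C(Circle, S)
  injective : Function.Injective map

namespace SimpleClosedCurve

variable {S : Type*} [TopologicalSpace S]

/-- The image of a simple closed curve. -/
def image (α : SimpleClosedCurve S) : Set S := Set.range α.map

/-- Free homotopy of simple closed curves in `S`. -/
def Homotopic (α α' : SimpleClosedCurve S) : Prop := α.map.Homotopic α'.map

end SimpleClosedCurve

/-- The geometric intersection number `i(α, β)`: the minimum of the number of points of `α' ∩ β'`
over all simple closed curves `α'`, `β'` freely homotopic to `α`, `β`. (An infinite intersection
counts as `⊤`; the infimum of a nonempty set in `ℕ∞` is attained.) -/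
noncomputable def intersectionNumber {S : Type*} [TopologicalSpace S]
    (α β : SimpleClosedCurve S) : ℕ∞ :=
  sInf {m : ℕ∞ | ∃ α' β' : SimpleClosedCurve S, α.Homotopic α' ∧ β.Homotopic β' ∧
    (α'.image ∩ β'.image).encard = m}

/-- The subset `U` of a topological space is homeomorphic to an open disc. -/
def IsOpenDisc {Y : Type*} [TopologicalSpace Y] (U : Set Y) : Prop :=
  Nonempty (U ≃ₜ Metric.ball (0 : ℂ) 1)

/-- The subset `U` of the punctured surface is a once-punctured open disc, the missing point being
one of the punctures of the surface. -/
def IsOncePuncturedDisc {X : Type*} [TopologicalSpace X] {P : Finset X}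
    (U : Set (Punctured P)) : Prop :=
  ∃ p ∈ P, IsOpenDisc (insert p (Subtype.val '' U : Set X))

/-- The curves `α` and `β` fill the punctured surface: they have representatives `α'`, `β'` in
minimal position such that every connected component of the complement of `α' ∪ β'` is an open disc
or a once-punctured open disc. -/
def Fill {X : Type*} [TopologicalSpace X] {P : Finset X}
    (α β : SimpleClosedCurve (Punctured P)) : Prop :=
  ∃ α' β' : SimpleClosedCurve (Punctured P), α.Homotopic α' ∧ β.Homotopic β' ∧
    (α'.image ∩ β'.image).encard = intersectionNumber α β ∧
    ∀ x ∈ (α'.image ∪ β'.image)ᶜ,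
      IsOpenDisc (connectedComponentIn (α'.image ∪ β'.image)ᶜ x) ∨
      IsOncePuncturedDisc (connectedComponentIn (α'.image ∪ β'.image)ᶜ x)

end FillingCurves

/-! Continuous angle-valued maps modulo those with a continuous real lift form the first integral
cohomology group, and the proof compares ranks in this group. It needs neither tameness nor
transversality of the curves, and no cell decomposition.

Let `G` be the union of two filling representatives, with `k` intersection points, viewed in the
closed surface `X`. On the graph-like set `G` the rank is at most `k + 1`. Real lifts along the two
curves have two degrees as obstructions, and the offsets at the `k` points must agree up to one
common shift. So any `k + 2` classes satisfy a nontrivial relation on `G`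
(`exists_relation_on_curves`).

Restriction from `X` minus the punctures to `G` is injective. A map vanishing on `G` is close to
zero near the end of each complementary disc, so it has no winding about the possible puncture there
and lifts over the disc; these lifts glue by compactness (`exists_lift_rel`). For this, the
components in the punctured surface must first be turned into discs of `X` with at most one puncture
each (`isOpenDisc_component_of_punctured`).

There remain enough independent classes to exhibit. The explicit model carries `2g` of them: angles
about the holes and angles around the tubes (`independent_standardAngle`). When `n ≥ 1`, a further
`n - 1` wind about all punctures but one (`exists_essentialAt`). Hence `2g + n - 1 ≤ k + 1` for `n ≥
1`, and `2g ≤ k + 1` for `n = 0` (`card_add_card_le`). The bound holds for every pair of curves with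
finite intersection and such a complement; minimal position only identifies `k` with the geometric
intersection number. -/

namespace FillingCurves

open Set Filter Topology Real

/-! ### Real lifts of angle-valued maps -/

section Lifting

lemma angle_isCoveringMap_coe : IsCoveringMap ((↑) : ℝ → Real.Angle) :=
  AddCircle.isCoveringMap_coe (2 * π)

/-- The principal value is the complex argument of the corresponding point of the unit circle, so it
jumps only on the negative real axis. -/
lemma continuousAt_toReal {θ : Real.Angle} (h : θ ≠ π) : ContinuousAt Real.Angle.toReal θ := by
  have h1 : ∀ θ : Real.Angle, θ.toReal = Complex.arg (θ.toCircle : ℂ) := by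
    intro θ
    conv_lhs => rw [← Real.Angle.arg_toCircle θ]
    exact Complex.arg_coe_angle_toReal_eq_arg _
  have h2 : ContinuousAt (fun θ : Real.Angle => Complex.arg (θ.toCircle : ℂ)) θ := by
    apply ContinuousAt.comp (g := Complex.arg)
    · apply Complex.continuousAt_arg
      rw [Complex.mem_slitPlane_iff_arg]
      refine ⟨?_, Circle.coe_ne_zero _⟩
      rw [← h1]
      intro hh
      exact h (Real.Angle.toReal_eq_pi_iff.1 hh)
    · exact (continuous_subtype_val.comp AddCircle.homeomorphCircle'.continuous).continuousAt
  exact h2.congr (Eventually.of_forall fun θ => (h1 θ).symm)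

/-- A continuous real function on a preconnected set that only takes multiples of `2π` as values
is constant. -/
lemma eq_of_coe_angle_eq_zero {Y : Type*} [TopologicalSpace Y] {S : Set Y}
    (hS : IsPreconnected S) {u : Y → ℝ} (hu : ContinuousOn u S)
    (h : ∀ x ∈ S, (u x : Real.Angle) = 0) {x y : Y} (hx : x ∈ S) (hy : y ∈ S) : u x = u y := by
  have hmem : MapsTo u S (AddSubgroup.zmultiples (2 * π) : Set ℝ) := by
    intro z hz
    obtain ⟨n, hn⟩ := Real.Angle.coe_eq_zero_iff.1 (h z hz)
    exact ⟨n, hn⟩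
  have hd : DiscreteTopology (AddSubgroup.zmultiples (2 * π)) := inferInstance
  exact hS.constant_of_mapsTo ⟨hd⟩ hu hmem hx hy

/-- Two lifts of the same angle, up to a fixed rotation, differ by a constant. All comparisons of
lifts and all degree computations rest on this rigidity. -/
lemma sub_eq_sub_of_coe_eq {Y : Type*} [TopologicalSpace Y] {S : Set Y}
    (hS : IsPreconnected S) {u v : Y → ℝ} (hu : ContinuousOn u S) (hv : ContinuousOn v S)
    {c : Real.Angle} (h : ∀ x ∈ S, (u x : Real.Angle) = v x + c) {x y : Y} (hx : x ∈ S)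
    (hy : y ∈ S) : u x - v x = u y - v y := by
  have := eq_of_coe_angle_eq_zero hS (u := fun z => u z - v z - c.toReal)
    ((hu.sub hv).sub continuousOn_const) (fun z hz => by simp [h z hz]) hx hy
  simpa using this

lemma exists_lift {A : Type*} [TopologicalSpace A] [SimplyConnectedSpace A]
    [LocallyPathConnectedSpace A] (u : A → Real.Angle) (hu : Continuous u) :
    ∃ L : A → ℝ, Continuous L ∧ ∀ z, (L z : Real.Angle) = u z := by
  obtain ⟨a₀⟩ : Nonempty A := inferInstance
  obtain ⟨F, ⟨-, hF⟩, -⟩ := angle_isCoveringMap_coe.existsUnique_continuousMap_lifts ⟨u, hu⟩ a₀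
    (u a₀).toReal (by simp)
  exact ⟨F, F.continuous, fun z => congrFun hF z⟩

lemma isPreconnected_re_gt (c : ℝ) : IsPreconnected {z : ℂ | c < z.re} :=
  (convex_halfSpace_re_gt c).isPreconnected

lemma exp_image_re_gt {R : ℝ} (hR : 0 < R) :
    Complex.exp '' {z : ℂ | Real.log R < z.re} = {z : ℂ | R < ‖z‖} := by
  ext z
  constructor
  · rintro ⟨w, hw, rfl⟩
    simp only [mem_ofPred_eq, Complex.norm_exp] at hw ⊢
    rwa [Real.log_lt_iff_lt_exp hR] at hw
  · intro hz
    have hz' : R < ‖z‖ := hz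
    have h0 : z ≠ 0 := by
      rintro rfl
      simp at hz'
      linarith
    refine ⟨Complex.log z, ?_, Complex.exp_log h0⟩
    simp only [mem_ofPred_eq, Complex.log_re]
    exact Real.log_lt_log hR hz'

lemma isPreconnected_norm_gt {R : ℝ} (hR : 0 < R) : IsPreconnected {z : ℂ | R < ‖z‖} := by
  rw [← exp_image_re_gt hR]
  exact (isPreconnected_re_gt _).image _ Complex.continuous_exp.continuousOn

/-- An angle-valued map on the plane that avoids `π` near infinity has a real lift that is given by
the principal value near infinity. -/
lemma exists_lift_plane {u : ℂ → Real.Angle} (hu : Continuous u) {R : ℝ} (hR : 0 < R)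
    (hπ : ∀ z, R < ‖z‖ → u z ≠ π) :
    ∃ L : ℂ → ℝ, Continuous L ∧ (∀ z, (L z : Real.Angle) = u z) ∧
      ∀ z, R < ‖z‖ → L z = (u z).toReal := by
  obtain ⟨L, hL, hLu⟩ := exists_lift u hu
  have hR' : (((R + 1 : ℝ)) : ℂ) ∈ {z : ℂ | R < ‖z‖} := by
    simp only [mem_ofPred_eq, Complex.norm_real, Real.norm_eq_abs]
    rw [abs_of_pos] <;> linarith
  set z₀ : ℂ := ((R + 1 : ℝ) : ℂ)
  refine ⟨fun z => L z - (L z₀ - (u z₀).toReal), hL.sub continuous_const, ?_, ?_⟩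
  · intro z
    simp [hLu]
  · intro z hz
    have := sub_eq_sub_of_coe_eq (isPreconnected_norm_gt hR) hL.continuousOn
      (v := fun z => (u z).toReal) (c := 0)
      (fun w hw => ((continuousAt_toReal (hπ w hw)).comp hu.continuousAt).continuousWithinAt)
      (fun w _ => by simp [hLu]) hz hR'
    simp only at this ⊢
    linarith

/-- The analogue of `exists_lift_plane` for the punctured plane. -/
lemma exists_lift_punctured_plane {u : ℂ → Real.Angle} (hu : ContinuousOn u {0}ᶜ) {R : ℝ}
    (hR : 0 < R) (hπ : ∀ z, R < ‖z‖ → u z ≠ π) :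
    ∃ L : ℂ → ℝ, ContinuousOn L {0}ᶜ ∧ (∀ z, z ≠ 0 → (L z : Real.Angle) = u z) ∧
      ∀ z, R < ‖z‖ → L z = (u z).toReal := by
  -- The exponential is the universal cover of the punctured plane; the lift is built upstairs and
  -- then shown to descend.
  have hv : Continuous (fun z => u (Complex.exp z)) :=
    hu.comp_continuous Complex.continuous_exp (fun z => Complex.exp_ne_zero z)
  obtain ⟨L₀, hL₀, hLu₀⟩ := exists_lift _ hv
  set S : Set ℂ := {z : ℂ | Real.log R < z.re} with hS
  have hSR : ∀ z ∈ S, R < ‖Complex.exp z‖ := by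
    intro z hz
    have : Complex.exp z ∈ {z : ℂ | R < ‖z‖} := by
      rw [← exp_image_re_gt hR]
      exact ⟨z, hz, rfl⟩
    exact this
  have hz₀ : ((Real.log R + 1 : ℝ) : ℂ) ∈ S := by
    simp only [hS, mem_ofPred_eq, Complex.ofReal_re]
    linarith
  set z₀ : ℂ := ((Real.log R + 1 : ℝ) : ℂ)
  set κ := L₀ z₀ - (u (Complex.exp z₀)).toReal with hκ
  set L : ℂ → ℝ := fun z => L₀ z - κ with hLdef
  have hL : Continuous L := hL₀.sub continuous_const
  have hLu : ∀ z, (L z : Real.Angle) = u (Complex.exp z) := by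
    intro z
    simp [hLdef, hκ, hLu₀]
  have hLS : ∀ z ∈ S, L z = (u (Complex.exp z)).toReal := by
    intro z hz
    have := sub_eq_sub_of_coe_eq (isPreconnected_re_gt (Real.log R)) hL₀.continuousOn
      (v := fun z => (u (Complex.exp z)).toReal) (c := 0)
      (fun w hw => (ContinuousAt.comp (f := fun z => u (Complex.exp z))
        (continuousAt_toReal (hπ _ (hSR w hw))) hv.continuousAt).continuousWithinAt)
      (fun w _ => by simp [hLu₀]) hz hz₀
    simp only [hLdef, hκ]
    linarith
  -- The change of `L` under a deck translation is constant. It vanishes on the half plane `S`,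
  -- which the translation preserves and where `L` is the principal value of a function of `exp z`.
  have hper : ∀ z w, Complex.exp z = Complex.exp w → L z = L w := by
    intro z w hzw
    obtain ⟨n, hn⟩ := Complex.exp_eq_exp_iff_exists_int.1 hzw
    have hT : Continuous (fun z : ℂ => L (z + n * (2 * π * Complex.I))) :=
      hL.comp (by fun_prop)
    have h1 := sub_eq_sub_of_coe_eq (S := univ) isPreconnected_univ hT.continuousOn
      hL.continuousOn (c := 0)
      (fun w _ => by
        rw [hLu, hLu, add_zero, Complex.exp_eq_exp_iff_exists_int.2 ⟨n, rfl⟩])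
      (mem_univ w) (mem_univ z₀)
    have h2 : L (z₀ + n * (2 * π * Complex.I)) = L z₀ := by
      rw [hLS _ hz₀, hLS, Complex.exp_eq_exp_iff_exists_int.2 ⟨n, rfl⟩]
      have : (z₀ + n * (2 * π * Complex.I)).re = z₀.re := by simp
      simpa [hS, this] using hz₀
    rw [hn]
    linarith
  refine ⟨fun z => L (Complex.log z), ?_, ?_, ?_⟩
  · intro z hz
    have hz : z ≠ 0 := hz
    apply ContinuousAt.continuousWithinAt
    by_cases hs : z ∈ Complex.slitPlane
    · exact hL.continuousAt.comp (continuousAt_clog hs)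
    -- Across the branch cut, `log (-z) + π i` is another local logarithm, and by `hper` the choice
    -- of logarithm does not affect `L`.
    · have hs' : -z ∈ Complex.slitPlane := by
        rcases Complex.mem_slitPlane_or_neg_mem_slitPlane hz with h | h
        · exact absurd h hs
        · exact h
      have hc : ContinuousAt (fun z => L (Complex.log (-z) + π * Complex.I)) z := by
        apply hL.continuousAt.comp
        exact ((continuousAt_clog hs').comp continuousAt_neg).add continuousAt_const
      refine hc.congr ?_
      filter_upwards [isOpen_ne.mem_nhds hz] with w hw
      apply hper
      rw [Complex.exp_add, Complex.exp_pi_mul_I, Complex.exp_log (neg_ne_zero.2 hw),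
        Complex.exp_log hw]
      ring
  · intro z hz
    rw [hLu, Complex.exp_log hz]
  · intro z hz
    have hz0 : z ≠ 0 := by
      rintro rfl
      simp at hz
      linarith
    have : Complex.log z ∈ S := by
      simp only [hS, mem_ofPred_eq, Complex.log_re]
      exact Real.log_lt_log hR hz
    change L (Complex.log z) = _
    rw [hLS _ this, Complex.exp_log hz0]

end Lifting

/-! ### Cohomology of the union of two curves -/

section CurvePair

variable {Y : Type*} [TopologicalSpace Y]

/-- A continuous map from a compact set to a Hausdorff space is closed, hence a quotient map onto
its image. -/
lemma continuousOn_image_of_comp [T2Space Y] {A Z : Type*} [TopologicalSpace A] [TopologicalSpace Z]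
    {K : Set A} (hK : IsCompact K) {p : A → Y} (hp : ContinuousOn p K) {θ : Y → Z}
    (hθ : ContinuousOn (θ ∘ p) K) : ContinuousOn θ (p '' K) := by
  rw [continuousOn_iff_isClosed]
  intro t ht
  obtain ⟨C, hC, hCt⟩ := continuousOn_iff_isClosed.1 hθ t ht
  refine ⟨p '' (K ∩ C), ?_, ?_⟩
  · exact ((hK.inter_right hC).image_of_continuousOn (hp.mono inter_subset_left)).isClosed
  · ext y
    constructor
    · rintro ⟨hy, x, hx, rfl⟩
      have : x ∈ (θ ∘ p) ⁻¹' t ∩ K := ⟨hy, hx⟩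
      rw [hCt] at this
      exact ⟨⟨x, ⟨hx, this.1⟩, rfl⟩, mem_image_of_mem _ hx⟩
    · rintro ⟨⟨x, ⟨hx, hxC⟩, rfl⟩, -⟩
      have : x ∈ C ∩ K := ⟨hxC, hx⟩
      rw [← hCt] at this
      exact ⟨this.1, mem_image_of_mem _ hx⟩

/-- A real function on the line whose value at `t` only depends on `Circle.exp t` descends along
an injective map of the circle. -/
lemma exists_descend [T2Space Y] {a : Circle → Y} (ha : Continuous a) (hinj : Function.Injective a)
    {h : ℝ → ℝ} (hh : Continuous h) (hper : ∀ t, h (t + 2 * π) = h t) :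
    ∃ θ : Y → ℝ, ContinuousOn θ (range a) ∧ ∀ t, θ (a (Circle.exp t)) = h t := by
  have hper' : ∀ s t, Circle.exp s = Circle.exp t → h s = h t := by
    intro s t hst
    obtain ⟨m, hm⟩ := Circle.exp_eq_exp.1 hst
    rw [hm]
    have : Function.Periodic h (2 * π) := hper
    exact this.int_mul m t
  have hθ : ∀ t, Function.extend (fun t => a (Circle.exp t)) h 0 (a (Circle.exp t)) = h t := by
    intro t
    have : Function.FactorsThrough h (fun t => a (Circle.exp t)) := fun s t hst =>
      hper' s t (hinj hst)
    exact this.extend_apply 0 t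
  refine ⟨Function.extend (fun t => a (Circle.exp t)) h 0, ?_, hθ⟩
  have hr : range a = (fun t => a (Circle.exp t)) '' Icc (-π) π := by
    ext y
    constructor
    · rintro ⟨c, rfl⟩
      refine ⟨Complex.arg c, ⟨(Complex.neg_pi_lt_arg _).le, Complex.arg_le_pi _⟩, ?_⟩
      simp
    · rintro ⟨t, -, rfl⟩
      exact ⟨_, rfl⟩
  rw [hr]
  apply continuousOn_image_of_comp isCompact_Icc
  · exact (ha.comp Circle.exp.continuous).continuousOn
  · exact hh.continuousOn.congr fun t _ => hθ t

/-- An angle-valued map along a closed curve has a real lift, with an integral degree. -/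
lemma exists_lift_curve {Y : Type*} {a : Circle → Y} {v : Y → Real.Angle} (hv : Continuous (v ∘ a)) :
    ∃ (h : ℝ → ℝ) (d : ℤ), Continuous h ∧ (∀ t, (h t : Real.Angle) = v (a (Circle.exp t))) ∧
      ∀ t, h (t + 2 * π) = h t + 2 * π * d := by
  obtain ⟨h, hc, hh⟩ := exists_lift (fun t : ℝ => v (a (Circle.exp t)))
    (hv.comp Circle.exp.continuous)
  have key : ∀ t, (h (t + 2 * π) : Real.Angle) = h t + 0 := by
    intro t
    rw [hh, hh, Circle.exp_add, Circle.exp_two_pi, mul_one, add_zero]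
  obtain ⟨d, hd⟩ := Real.Angle.angle_eq_iff_two_pi_dvd_sub.1 (show (h (0 + 2 * π) : Real.Angle) = h 0 by
    simpa using key 0)
  refine ⟨h, d, hc, hh, fun t => ?_⟩
  have := sub_eq_sub_of_coe_eq (S := univ) isPreconnected_univ
    (hc.comp (continuous_add_const (2 * π))).continuousOn hc.continuousOn (c := 0)
    (fun t _ => key t) (mem_univ t) (mem_univ 0)
  simp only [Function.comp] at this
  linarith

/-- Angle-valued maps on the union of two simple closed curves that meet in `k ≥ 1` points: any
`k + 2` of them satisfy an integral relation modulo maps with a real lift. -/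
lemma exists_relation_on_curves [T2Space Y] {a b : Circle → Y} (ha : Continuous a) (hb : Continuous b)
    (hai : Function.Injective a) (hbi : Function.Injective b)
    (hfin : (range a ∩ range b).Finite) (hne : (range a ∩ range b).Nonempty)
    {I : Type*} [Fintype I] (v : I → Y → Real.Angle)
    (hv : ∀ i, ContinuousOn (v i) (range a ∪ range b))
    (hcard : (range a ∩ range b).ncard + 1 < Fintype.card I) :
    ∃ n : I → ℤ, n ≠ 0 ∧ ∃ θ : Y → ℝ, ContinuousOn θ (range a ∪ range b) ∧
      ∀ x ∈ range a ∪ range b, (θ x : Real.Angle) = ∑ i, n i • v i x := by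
  have hva : ∀ i, Continuous (v i ∘ a) := fun i =>
    (hv i).comp_continuous ha fun c => Or.inl ⟨c, rfl⟩
  have hvb : ∀ i, Continuous (v i ∘ b) := fun i =>
    (hv i).comp_continuous hb fun c => Or.inr ⟨c, rfl⟩
  choose ha' d hac hav had using fun i => exists_lift_curve (hva i)
  choose hb' e hbc hbv hbe using fun i => exists_lift_curve (hvb i)
  have hsurj : ∀ c : Circle, ∃ t : ℝ, Circle.exp t = c := fun c => ⟨Complex.arg c, by simp⟩
  have hx : ∀ x : (range a ∩ range b : Set Y), ∃ s t : ℝ, a (Circle.exp s) = x ∧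
      b (Circle.exp t) = x := by
    rintro ⟨x, ⟨c, hc⟩, ⟨c', hc'⟩⟩
    obtain ⟨s, rfl⟩ := hsurj c
    obtain ⟨t, rfl⟩ := hsurj c'
    exact ⟨s, t, hc, hc'⟩
  choose s t hs ht using hx
  have hm : ∀ i x, ∃ m : ℤ, ha' i (s x) - hb' i (t x) = 2 * π * m := by
    intro i x
    apply Real.Angle.angle_eq_iff_two_pi_dvd_sub.1
    rw [hav, hbv, hs, ht]
  choose m hm using hm
  have := hfin.fintype
  obtain ⟨x₀, hx₀⟩ := hne
  -- Unknowns: the coefficients and one common offset between the lifts on the two curves.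
  -- Equations: both total degrees vanish, and the offset is the same at each intersection point.
  -- There are `card I + 1` unknowns and `k + 2` equations, so the kernel is nonzero.
  let Λ : (I ⊕ Unit → ℤ) →ₗ[ℤ] (Bool ⊕ (range a ∩ range b : Set Y) → ℤ) :=
    { toFun := fun n => Sum.elim
        (fun β => ∑ i, n (Sum.inl i) * (if β then d i else e i))
        (fun x => ∑ i, n (Sum.inl i) * m i x - n (Sum.inr ()))
      map_add' := by
        intro n n'
        ext (β | x)
        · cases β <;> simp [add_mul, Finset.sum_add_distrib]
        · simp [add_mul, Finset.sum_add_distrib]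
          ring
      map_smul' := by
        intro r n
        ext (β | x)
        · cases β <;> simp [Finset.mul_sum, mul_assoc]
        · simp [Finset.mul_sum, mul_assoc, mul_sub] }
  have hΛ : ¬ Function.Injective Λ := by
    intro hinj
    have := card_le_of_injective ℤ Λ hinj
    rw [Fintype.card_sum, Fintype.card_sum, Fintype.card_bool, Fintype.card_unit,
      ← Nat.card_eq_fintype_card (α := (range a ∩ range b : Set Y)), Nat.card_coe_set_eq] at this
    omega
  rw [← LinearMap.ker_eq_bot, Submodule.eq_bot_iff] at hΛ
  push Not at hΛ
  obtain ⟨N, hN, hN0⟩ := hΛ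
  rw [LinearMap.mem_ker] at hN
  have hd0 : ∑ i, N (Sum.inl i) * d i = 0 := by simpa [Λ] using congrFun hN (Sum.inl true)
  have he0 : ∑ i, N (Sum.inl i) * e i = 0 := by simpa [Λ] using congrFun hN (Sum.inl false)
  have hm0 : ∀ x, ∑ i, N (Sum.inl i) * m i x = N (Sum.inr ()) := by
    intro x
    have := congrFun hN (Sum.inr x)
    simpa [Λ, sub_eq_zero] using this
  have hcoe : ∀ (f : I → ℝ) (z : I → Real.Angle), (∀ i, (f i : Real.Angle) = z i) →
      ((∑ i, N (Sum.inl i) * f i : ℝ) : Real.Angle) = ∑ i, N (Sum.inl i) • z i := by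
    intro f z hfz
    have : ((∑ i, N (Sum.inl i) * f i : ℝ) : Real.Angle) =
      Real.Angle.coeHom (∑ i, N (Sum.inl i) • f i) := by
      simp only [zsmul_eq_mul]
      rfl
    rw [this, map_sum]
    refine Finset.sum_congr rfl fun i _ => ?_
    rw [map_zsmul, ← hfz]
    rfl
  obtain ⟨θa, hθa, hθa'⟩ := exists_descend ha hai
    (h := fun t => ∑ i, N (Sum.inl i) * ha' i t) (by fun_prop) (by
      intro t
      have : (∑ i, (N (Sum.inl i) : ℝ) * d i) = 0 := by exact_mod_cast hd0
      simp only [had, mul_add, Finset.sum_add_distrib, add_eq_left]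
      calc ∑ i, (N (Sum.inl i) : ℝ) * (2 * π * d i) = 2 * π * ∑ i, (N (Sum.inl i) : ℝ) * d i := by
            rw [Finset.mul_sum]; exact Finset.sum_congr rfl fun i _ => by ring
        _ = 0 := by rw [this, mul_zero])
  -- Shifting by the common offset makes the lift on the second curve agree with the first at the
  -- intersection points.
  obtain ⟨θb, hθb, hθb'⟩ := exists_descend hb hbi
    (h := fun t => ∑ i, N (Sum.inl i) * hb' i t + 2 * π * N (Sum.inr ())) (by fun_prop) (by
      intro t
      have : (∑ i, (N (Sum.inl i) : ℝ) * e i) = 0 := by exact_mod_cast he0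
      simp only [hbe, mul_add, Finset.sum_add_distrib, add_left_inj, add_eq_left]
      calc ∑ i, (N (Sum.inl i) : ℝ) * (2 * π * e i) = 2 * π * ∑ i, (N (Sum.inl i) : ℝ) * e i := by
            rw [Finset.mul_sum]; exact Finset.sum_congr rfl fun i _ => by ring
        _ = 0 := by rw [this, mul_zero])
  have hab : ∀ x ∈ range a ∩ range b, θa x = θb x := by
    intro x hx
    have h1 := hθa' (s ⟨x, hx⟩)
    have h2 := hθb' (t ⟨x, hx⟩)
    rw [hs] at h1
    rw [ht] at h2
    rw [h1, h2, ← sub_eq_iff_eq_add', ← Finset.sum_sub_distrib]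
    have : (∑ i, (N (Sum.inl i) : ℝ) * m i ⟨x, hx⟩) = N (Sum.inr ()) := by
      exact_mod_cast hm0 ⟨x, hx⟩
    rw [← this, Finset.mul_sum]
    refine Finset.sum_congr rfl fun i _ => ?_
    rw [← mul_sub, hm]
    ring
  classical
  have hac' : IsClosed (range a) := (isCompact_range ha).isClosed
  have hbc' : IsClosed (range b) := (isCompact_range hb).isClosed
  refine ⟨fun i => N (Sum.inl i), ?_, (range a).piecewise θa θb, ?_, ?_⟩
  -- The offset alone cannot be nonzero: the equation at an intersection point expresses it through
  -- the other coefficients. This uses that the curves meet.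
  · intro h0
    apply hN0
    have h0' : ∀ i, N (Sum.inl i) = 0 := fun i => congrFun h0 i
    ext (i | u)
    · exact h0' i
    · have := hm0 ⟨x₀, hx₀⟩
      simpa [h0'] using this.symm
  · have h1 : ContinuousOn ((range a).piecewise θa θb) (range a) :=
      hθa.congr fun x hx => piecewise_eq_of_mem _ _ _ hx
    have h2 : ContinuousOn ((range a).piecewise θa θb) (range b) := by
      refine hθb.congr fun x hx => ?_
      by_cases hxa : x ∈ range a
      · rw [piecewise_eq_of_mem _ _ _ hxa, hab x ⟨hxa, hx⟩]
      · rw [piecewise_eq_of_notMem _ _ _ hxa]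
    exact h1.union_of_isClosed h2 hac' hbc'
  · intro x hx
    by_cases hxa : x ∈ range a
    · rw [piecewise_eq_of_mem _ _ _ hxa]
      obtain ⟨c, rfl⟩ := hxa
      obtain ⟨s, rfl⟩ := hsurj c
      rw [hθa']
      exact hcoe _ _ fun i => hav i s
    · rw [piecewise_eq_of_notMem _ _ _ hxa]
      obtain ⟨c, rfl⟩ := hx.resolve_left hxa
      obtain ⟨s, rfl⟩ := hsurj c
      rw [hθb', Real.Angle.coe_add, hcoe _ _ fun i => hbv i s]
      have : ((2 * π * N (Sum.inr ()) : ℝ) : Real.Angle) = 0 := by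
        rw [Real.Angle.coe_eq_zero_iff]
        exact ⟨N (Sum.inr ()), by simp [mul_comm]⟩
      simp [this]

end CurvePair

/-! ### Lifting relative to a set with disc complement -/

section Gluing

variable {X : Type*} [TopologicalSpace X]

/-- The disc is identified with the plane, with its possible point of `Q` at the origin. Outside a
compact set the angle avoids `π`, so the principal value is a lift near the end; this rules out
winding about the origin. Agreement with the principal value off `K` is what allows lifts over
different discs to be glued. -/
lemma exists_lift_of_isOpenDisc {W Q T : Set X} (hW : IsOpenDisc W)
    (hQ : (W ∩ Q).Subsingleton) {f : X → Real.Angle} (hf : ContinuousOn f (W \ Q))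
    (hT : IsCompact T) (hTW : T ⊆ W) (hπ : ∀ x ∈ W \ T, f x ≠ π) :
    ∃ (l : X → ℝ) (K : Set X), IsCompact K ∧ K ⊆ W ∧ ContinuousOn l (W \ Q) ∧
      (∀ x ∈ W \ Q, (l x : Real.Angle) = f x) ∧ ∀ x ∈ W \ K, l x = (f x).toReal := by
  obtain ⟨φ⟩ := hW
  have hψ : ∃ ψ : W ≃ₜ ℂ, ∀ x : W, (x : X) ∈ Q → ψ x = 0 := by
    by_cases h : (W ∩ Q).Nonempty
    · obtain ⟨q, hqW, hqQ⟩ := h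
      refine ⟨(φ.trans Homeomorph.unitBall.symm).trans
        (Homeomorph.subRight ((φ.trans Homeomorph.unitBall.symm) ⟨q, hqW⟩)), ?_⟩
      rintro ⟨x, hx⟩ hxQ
      have : x = q := hQ ⟨hx, hxQ⟩ ⟨hqW, hqQ⟩
      subst this
      simp
    · refine ⟨φ.trans Homeomorph.unitBall.symm, ?_⟩
      rintro ⟨x, hx⟩ hxQ
      exact absurd ⟨x, hx, hxQ⟩ h
  obtain ⟨ψ, hψ⟩ := hψ
  obtain ⟨R, hR, hTR⟩ : ∃ R > 0, ψ '' (Subtype.val ⁻¹' T) ⊆ Metric.closedBall 0 R := by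
    have hc : IsCompact (ψ '' (Subtype.val ⁻¹' T)) := by
      apply IsCompact.image _ ψ.continuous
      rw [Subtype.isCompact_iff, Subtype.image_preimage_coe, inter_eq_right.2 hTW]
      exact hT
    obtain ⟨R, hR⟩ := hc.isBounded.subset_closedBall 0
    exact ⟨max R 1, by positivity, hR.trans (Metric.closedBall_subset_closedBall (le_max_left _ _))⟩
  set u : ℂ → Real.Angle := fun z => f (ψ.symm z) with hu
  have huc : ContinuousOn u {z | (ψ.symm z : X) ∉ Q} := by
    apply hf.comp (continuous_subtype_val.comp ψ.symm.continuous).continuousOn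
    intro z hz
    exact ⟨(ψ.symm z).2, hz⟩
  have huπ : ∀ z, R < ‖z‖ → u z ≠ π := by
    intro z hz
    apply hπ
    refine ⟨(ψ.symm z).2, fun h => ?_⟩
    have := hTR ⟨ψ.symm z, h, ψ.apply_symm_apply z⟩
    rw [mem_closedBall_zero_iff] at this
    linarith
  have hL : ∃ L : ℂ → ℝ, ContinuousOn L {z | (ψ.symm z : X) ∉ Q} ∧
      (∀ z, (ψ.symm z : X) ∉ Q → (L z : Real.Angle) = u z) ∧
      ∀ z, R < ‖z‖ → L z = (u z).toReal := by
    by_cases h : (ψ.symm 0 : X) ∈ Q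
    · have hset : {z | (ψ.symm z : X) ∉ Q} = {0}ᶜ := by
        ext z
        simp only [mem_ofPred_eq, mem_compl_iff, mem_singleton_iff, not_iff_not]
        constructor
        · intro hz
          simpa using hψ _ hz
        · rintro rfl
          exact h
      rw [hset] at huc ⊢
      obtain ⟨L, h1, h2, h3⟩ := exists_lift_punctured_plane huc hR huπ
      refine ⟨L, h1, fun z hz => h2 z ?_, h3⟩
      rintro rfl
      exact hz h
    · have hset : {z | (ψ.symm z : X) ∉ Q} = univ := by
        ext z
        simp only [mem_ofPred_eq, mem_univ, iff_true]
        intro hz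
        have := hψ _ hz
        rw [ψ.apply_symm_apply] at this
        rw [this] at hz
        exact h hz
      rw [hset] at huc ⊢
      obtain ⟨L, h1, h2, h3⟩ := exists_lift_plane (continuousOn_univ.1 huc) hR huπ
      exact ⟨L, h1.continuousOn, fun z _ => h2 z, h3⟩
  obtain ⟨L, hL1, hL2, hL3⟩ := hL
  classical
  have hl : ∀ x (hx : x ∈ W), (fun x => if h : x ∈ W then L (ψ ⟨x, h⟩) else 0) x = L (ψ ⟨x, hx⟩) :=
    fun x hx => dif_pos hx
  refine ⟨fun x => if h : x ∈ W then L (ψ ⟨x, h⟩) else 0,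
    Subtype.val '' (ψ.symm '' Metric.closedBall 0 R), ?_, ?_, ?_, ?_, ?_⟩
  · exact ((isCompact_closedBall 0 R).image ψ.symm.continuous).image continuous_subtype_val
  · rintro _ ⟨x, -, rfl⟩
    exact x.2
  · rw [continuousOn_iff_continuous_domRestrict]
    have : ((W \ Q).domRestrict fun x => if h : x ∈ W then L (ψ ⟨x, h⟩) else 0) =
        fun x : (W \ Q : Set X) => L (ψ ⟨x, x.2.1⟩) := by
      ext x
      exact dif_pos x.2.1
    rw [this]
    apply hL1.comp_continuous
    · exact ψ.continuous.comp (by fun_prop)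
    · intro x
      simpa using x.2.2
  · intro x hx
    rw [hl x hx.1, hL2]
    · simp [hu]
    · simpa using hx.2
  · intro x hx
    rw [hl x hx.1, hL3]
    · simp [hu]
    · by_contra hcon
      apply hx.2
      refine ⟨⟨x, hx.1⟩, ⟨ψ ⟨x, hx.1⟩, ?_, by simp⟩, rfl⟩
      simpa using hcon

/-- If the components of the complement of the closed set `G` are open discs with at most one point
of `Q` each, then an angle-valued map off `Q` that vanishes on `G` has a real lift that vanishes
on `G`. -/
lemma exists_lift_rel [CompactSpace X] [T2Space X] [LocallyConnectedSpace X] {G Q : Set X}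
    (hG : IsClosed G) (hQ : Q.Finite) (hQG : ∀ x ∈ Q, x ∉ G)
    (hdisc : ∀ x ∈ Gᶜ, IsOpenDisc (connectedComponentIn Gᶜ x))
    (hsub : ∀ x ∈ Gᶜ, (connectedComponentIn Gᶜ x ∩ Q).Subsingleton)
    {f : X → Real.Angle} (hf : ContinuousOn f Qᶜ) (hf0 : ∀ x ∈ G, f x = 0) :
    ∃ l : X → ℝ, ContinuousOn l Qᶜ ∧ (∀ x ∈ G, l x = 0) ∧
      ∀ x, x ∉ Q → (l x : Real.Angle) = f x := by
  set C : X → Set X := connectedComponentIn Gᶜ with hC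
  have hCo : ∀ x, IsOpen (C x) := fun x => hG.isOpen_compl.connectedComponentIn
  set U : Set X := Qᶜ ∩ f ⁻¹' {(π : Real.Angle)}ᶜ with hU
  have hUo : IsOpen U := hf.isOpen_inter_preimage hQ.isClosed.isOpen_compl isOpen_compl_singleton
  have hGU : G ⊆ U := by
    intro x hx
    refine ⟨fun h => hQG x h hx, ?_⟩
    simp only [mem_preimage, hf0 x hx, mem_compl_iff, mem_singleton_iff]
    exact fun h => Real.Angle.pi_ne_zero h.symm
  have hT : IsCompact Uᶜ := hUo.isClosed_compl.isCompact
  have hCT : ∀ x, IsCompact (C x ∩ Uᶜ) := by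
    intro x
    have : C x ∩ Uᶜ = closure (C x) ∩ Uᶜ := by
      apply subset_antisymm (inter_subset_inter_left _ subset_closure)
      rintro y ⟨hy, hyU⟩
      refine ⟨?_, hyU⟩
      have hyG : y ∈ Gᶜ := fun h => hyU (hGU h)
      obtain ⟨z, hzy, hzx⟩ := mem_closure_iff.1 hy _ (hCo y) (mem_connectedComponentIn hyG)
      rw [hC, connectedComponentIn_eq hzx, ← connectedComponentIn_eq hzy]
      exact mem_connectedComponentIn hyG
    rw [this]
    exact hT.inter_left isClosed_closure
  have key : ∀ W : Set X, ∃ (l : X → ℝ) (K : Set X), W ∈ range C →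
      IsCompact K ∧ K ⊆ W ∧ (W ∩ Uᶜ = ∅ → K = ∅) ∧ ContinuousOn l (W \ Q) ∧
      (∀ x ∈ W \ Q, (l x : Real.Angle) = f x) ∧ ∀ x ∈ W \ K, l x = (f x).toReal := by
    intro W
    by_cases hW : W ∈ range C
    swap
    · exact ⟨0, ∅, fun h => absurd h hW⟩
    obtain ⟨x, rfl⟩ := hW
    by_cases hxT : C x ∩ Uᶜ = ∅
    · refine ⟨fun y => (f y).toReal, ∅, fun _ => ⟨isCompact_empty, empty_subset _, fun _ => rfl,
        ?_, fun y _ => by simp, fun y _ => rfl⟩⟩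
      intro y hy
      have hyU : y ∈ U := by
        by_contra h
        have : y ∈ C x ∩ Uᶜ := ⟨hy.1, h⟩
        rw [hxT] at this
        exact this
      exact ((continuousAt_toReal hyU.2).comp
        (hf.continuousAt (hQ.isClosed.isOpen_compl.mem_nhds hy.2))).continuousWithinAt
    · have hxG : x ∈ Gᶜ := by
        by_contra h
        apply hxT
        simp [hC, connectedComponentIn_eq_empty h]
      obtain ⟨l, K, h1, h2, h3, h4, h5⟩ := exists_lift_of_isOpenDisc (hdisc x hxG) (hsub x hxG)
        (f := f) (hf.mono fun y hy => hy.2) (hCT x) inter_subset_left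
        (fun y hy => (not_not.1 fun h => hy.2 ⟨hy.1, h⟩ : y ∈ U).2)
      exact ⟨l, K, fun _ => ⟨h1, h2, fun h => absurd h hxT, h3, h4, h5⟩⟩
  choose l K hlK using key
  obtain ⟨t, ht⟩ := hT.elim_finite_subcover C hCo (by
    intro x hx
    exact mem_iUnion.2 ⟨x, mem_connectedComponentIn fun h => hx (hGU h)⟩)
  -- Only finitely many components meet `Uᶜ`, and on all others `K` is empty. Thus `B` contains
  -- every exceptional compact set and is closed even if there are infinitely many components.
  set B : Set X := ⋃ x ∈ t, K (C x) with hB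
  have hBcl : IsClosed B := by
    apply Set.Finite.isClosed_biUnion t.finite_toSet
    intro x _
    exact (hlK (C x) ⟨x, rfl⟩).1.isClosed
  have hBG : ∀ x ∈ G, x ∉ B := by
    intro x hx hxB
    simp only [hB, mem_iUnion] at hxB
    obtain ⟨y, -, hy⟩ := hxB
    exact connectedComponentIn_subset _ _ ((hlK (C y) ⟨y, rfl⟩).2.1 hy) hx
  have hout : ∀ y ∈ Gᶜ, y ∉ B → l (C y) y = (f y).toReal := by
    intro y hy hyB
    refine (hlK (C y) ⟨y, rfl⟩).2.2.2.2.2 y ⟨mem_connectedComponentIn hy, fun hyK => ?_⟩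
    have hne : C y ∩ Uᶜ ≠ ∅ := by
      intro h
      rw [(hlK (C y) ⟨y, rfl⟩).2.2.1 h] at hyK
      exact hyK
    obtain ⟨z, hzy, hzU⟩ := nonempty_iff_ne_empty.2 hne
    obtain ⟨x, hx, hzx⟩ := mem_iUnion₂.1 (ht hzU)
    apply hyB
    refine mem_iUnion₂.2 ⟨x, hx, ?_⟩
    have : C x = C y := by
      rw [hC, connectedComponentIn_eq hzx, connectedComponentIn_eq hzy]
    rwa [this]
  classical
  set L : X → ℝ := fun x => if x ∈ G then 0 else l (C x) x with hL
  have hLG : ∀ x ∈ G, L x = 0 := fun x hx => if_pos hx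
  have hLC : ∀ x ∉ G, L x = l (C x) x := fun x hx => if_neg hx
  refine ⟨L, ?_, hLG, ?_⟩
  · intro x hxQ
    apply ContinuousAt.continuousWithinAt
    by_cases hx : x ∈ G
    -- At a point of `G` the glued function coincides nearby with the principal value of `f`, which
    -- is continuous there because `f x = 0`.
    · have hc : ContinuousAt (fun y => (f y).toReal) x :=
        (continuousAt_toReal (hGU hx).2).comp
          (hf.continuousAt (hQ.isClosed.isOpen_compl.mem_nhds hxQ))
      refine hc.congr ?_
      filter_upwards [hBcl.isOpen_compl.mem_nhds (hBG x hx)] with y hy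
      by_cases hyG : y ∈ G
      · rw [hLG y hyG, hf0 y hyG, Real.Angle.toReal_zero]
      · rw [hLC y hyG, hout y hyG hy]
    · have hxC : x ∈ C x := mem_connectedComponentIn hx
      have hc : ContinuousAt (l (C x)) x :=
        (hlK (C x) ⟨x, rfl⟩).2.2.2.1.continuousAt
          (((hCo x).sdiff hQ.isClosed).mem_nhds ⟨hxC, hxQ⟩)
      refine hc.congr ?_
      filter_upwards [(hCo x).mem_nhds hxC] with y hy
      rw [hLC y (connectedComponentIn_subset _ _ hy), hC, connectedComponentIn_eq hy]
  · intro x hxQ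
    by_cases hx : x ∈ G
    · rw [hLG x hx, hf0 x hx, Real.Angle.coe_zero]
    · rw [hLC x hx]
      exact (hlK (C x) ⟨x, rfl⟩).2.2.2.2.1 x ⟨mem_connectedComponentIn hx, hxQ⟩

end Gluing

/-! ### The rank inequality -/

section Count

variable {X : Type*} [TopologicalSpace X]

/-- The angle-valued map `f` has nonzero winding number about `q`: no nonzero multiple of `f`,
plus a map continuous at `q`, has a real lift on a punctured neighbourhood of `q`. -/
def EssentialAt (f : X → Real.Angle) (q : X) : Prop :=
  ∀ (n : ℤ) (s : X → Real.Angle), ContinuousAt s q → ∀ L : X → ℝ,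
    (∀ᶠ x in 𝓝[≠] q, ContinuousAt L x ∧ (L x : Real.Angle) = n • f x + s x) → n = 0

/-- The maps `u i` are independent in the group of angle-valued maps modulo those that have a real
lift, that is, in the first cohomology group. -/
def IndependentAngleMaps {ι : Type*} [Fintype ι] (u : ι → X → Real.Angle) : Prop :=
  ∀ n : ι → ℤ, (∃ θ : X → ℝ, Continuous θ ∧ ∀ x, (θ x : Real.Angle) = ∑ i, n i • u i x) → n = 0

/-- Tietze extension: a lift on the curves becomes a real function on the whole surface. Subtracting
it reduces to angle maps that vanish on the curves. -/
lemma exists_extension_lift [CompactSpace X] [T2Space X] {G : Set X} (hG : IsClosed G)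
    {θ : X → ℝ} (hθ : ContinuousOn θ G) : ∃ θ' : X → ℝ, Continuous θ' ∧ ∀ x ∈ G, θ' x = θ x := by
  obtain ⟨θ', hθ'⟩ := ContinuousMap.exists_restrict_eq hG
    (⟨G.domRestrict θ, continuousOn_iff_continuous_domRestrict.1 hθ⟩ : C(G, ℝ))
  exact ⟨θ', θ'.continuous, fun x hx => DFunLike.congr_fun hθ' ⟨x, hx⟩⟩

/-- Two curves whose complement consists of discs intersect. -/
lemma inter_nonempty_of_discs [CompactSpace X] [T2Space X] [LocallyConnectedSpace X]
    [PreconnectedSpace X] {A B : Set X} (hA : IsClosed A) (hB : IsClosed B) (hAn : A.Nonempty)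
    (hBn : B.Nonempty)
    (hdisc : ∀ x ∈ (A ∪ B)ᶜ, IsOpenDisc (connectedComponentIn (A ∪ B)ᶜ x)) :
    (A ∩ B).Nonempty := by
  by_contra hne
  rw [not_nonempty_iff_eq_empty, ← disjoint_iff_inter_eq_empty] at hne
  classical
  have hBA : ∀ x ∈ B, x ∉ A := fun x hx hx' => disjoint_left.1 hne hx' hx
  -- If the sets were disjoint, a function equal to `0` on one and `2π` on the other would be the
  -- zero angle on both. Its lift vanishing on both would then differ from it by a nonconstant
  -- amount.
  have hcont : ContinuousOn (A.piecewise (fun _ => (0 : ℝ)) fun _ => 2 * π) (A ∪ B) := by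
    apply ContinuousOn.union_of_isClosed _ _ hA hB
    · exact continuousOn_const.congr fun x hx => piecewise_eq_of_mem _ _ _ hx
    · exact continuousOn_const.congr fun x hx => piecewise_eq_of_notMem _ _ _ (hBA x hx)
  obtain ⟨θ, hθ, hθG⟩ := exists_extension_lift (hA.union hB) hcont
  have hθA : ∀ x ∈ A, θ x = 0 := fun x hx => by
    rw [hθG x (Or.inl hx), piecewise_eq_of_mem _ _ _ hx]
  have hθB : ∀ x ∈ B, θ x = 2 * π := fun x hx => by
    rw [hθG x (Or.inr hx), piecewise_eq_of_notMem _ _ _ (hBA x hx)]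
  obtain ⟨l, hl, hl0, hlθ⟩ := exists_lift_rel (hA.union hB) (Q := ∅) finite_empty (by simp) hdisc
    (by simp) (f := fun x => (θ x : Real.Angle))
    (Real.Angle.continuous_coe.comp hθ).continuousOn (by
      rintro x (hx | hx)
      · simp [hθA x hx]
      · simp [hθB x hx])
  obtain ⟨x, hx⟩ := hAn
  obtain ⟨y, hy⟩ := hBn
  have := sub_eq_sub_of_coe_eq (S := univ) isPreconnected_univ (by simpa using hl)
    hθ.continuousOn (c := 0) (fun z _ => by simp [hlθ]) (mem_univ x) (mem_univ y)
  rw [hl0 x (Or.inl hx), hl0 y (Or.inr hy), hθA x hx, hθB y hy] at this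
  have := Real.pi_pos
  linarith

/-- Counting independent classes: curves with `k` intersection points and disc complement have
`k + 1` at least the number of independent classes on the surface and on its punctures. -/
theorem card_add_card_le [CompactSpace X] [T2Space X] [LocallyConnectedSpace X]
    [PreconnectedSpace X] {a b : Circle → X} (ha : Continuous a) (hb : Continuous b)
    (hai : Function.Injective a) (hbi : Function.Injective b)
    (hfin : (range a ∩ range b).Finite) {Q : Set X} (hQ : Q.Finite)
    (hQG : ∀ x ∈ Q, x ∉ range a ∪ range b)
    (hdisc : ∀ x ∈ (range a ∪ range b)ᶜ,
      IsOpenDisc (connectedComponentIn (range a ∪ range b)ᶜ x))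
    (hsub : ∀ x ∈ (range a ∪ range b)ᶜ,
      (connectedComponentIn (range a ∪ range b)ᶜ x ∩ Q).Subsingleton)
    {ι J : Type*} [Fintype ι] [Fintype J] {u : ι → X → Real.Angle}
    (huc : ∀ i, Continuous (u i)) (hui : IndependentAngleMaps u)
    {q : J → X} {f : J → X → Real.Angle}
    (hfc : ∀ j, ContinuousOn (f j) Qᶜ) (hfq : ∀ i j, i ≠ j → ContinuousAt (f j) (q i))
    (hfe : ∀ j, EssentialAt (f j) (q j)) :
    Fintype.card ι + Fintype.card J ≤ (range a ∩ range b).ncard + 1 := by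
  have hac : IsClosed (range a) := (isCompact_range ha).isClosed
  have hbc : IsClosed (range b) := (isCompact_range hb).isClosed
  have hGc := hac.union hbc
  have hne := inter_nonempty_of_discs hac hbc (range_nonempty a) (range_nonempty b) hdisc
  by_contra! hlt
  set v : ι ⊕ J → X → Real.Angle := Sum.elim u f with hv
  have hvc : ∀ i, ContinuousOn (v i) Qᶜ := by
    rintro (i | j)
    · exact (huc i).continuousOn
    · exact hfc j
  obtain ⟨n, hn, θ₀, hθ₀, hθ₀v⟩ := exists_relation_on_curves ha hb hai hbi hfin hne v
    (fun i => (hvc i).mono fun x hx h => hQG x h hx) (by rwa [Fintype.card_sum])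
  obtain ⟨θ, hθ, hθG⟩ := exists_extension_lift hGc hθ₀
  have hsum : ∀ S : Set X, (∀ i, ContinuousOn (v i) S) →
      ContinuousOn (fun x => ∑ i, n i • v i x) S := fun S h =>
    continuousOn_finsetSum _ fun i _ => (h i).zsmul (n i)
  obtain ⟨l, hl, -, hlf⟩ := exists_lift_rel hGc hQ hQG hdisc hsub
    (f := fun x => ∑ i, n i • v i x - θ x)
    ((hsum _ hvc).sub (Real.Angle.continuous_coe.comp hθ).continuousOn)
    (fun x hx => by simp [hθG x hx, hθ₀v x hx])
  -- At `q j` every summand other than the multiple of `f j` is continuous and goes into `s`; since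
  -- the whole sum has a real lift nearby, essentiality kills the coefficient.
  have hJ : ∀ j, n (Sum.inr j) = 0 := by
    intro j
    classical
    refine hfe j _ (fun x => ∑ i, n (Sum.inl i) • u i x +
      ∑ i, if i = j then 0 else n (Sum.inr i) • f i x) ?_ (fun x => l x + θ x) ?_
    · apply ContinuousAt.add
      · exact tendsto_finsetSum _ fun i _ => ((huc i).continuousAt).zsmul _
      · apply tendsto_finsetSum _ fun i _ => ?_
        by_cases hij : i = j
        · simp [hij]
        · simp only [hij, if_false]
          exact (hfq j i (Ne.symm hij)).zsmul _
    · have hQ' : (Q \ {q j})ᶜ ∈ 𝓝 (q j) :=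
        (hQ.sdiff).isClosed.isOpen_compl.mem_nhds (by simp)
      filter_upwards [self_mem_nhdsWithin, mem_nhdsWithin_of_mem_nhds hQ'] with x hx1 hx2
      have hxQ : x ∉ Q := fun h => hx2 ⟨h, hx1⟩
      refine ⟨(hl.continuousAt (hQ.isClosed.isOpen_compl.mem_nhds hxQ)).add hθ.continuousAt, ?_⟩
      rw [Real.Angle.coe_add, hlf x hxQ, sub_add_cancel, Fintype.sum_sum_type]
      simp only [hv, Sum.elim_inl, Sum.elim_inr]
      rw [add_left_comm]
      congr 1
      rw [← Finset.add_sum_erase _ _ (Finset.mem_univ j),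
        ← Finset.add_sum_erase _ _ (Finset.mem_univ j), if_pos rfl, zero_add]
      congr 1
      refine Finset.sum_congr rfl fun i hi => ?_
      rw [if_neg (Finset.ne_of_mem_erase hi)]
  have hs : ∀ x, ∑ i, n i • v i x = ∑ i, n (Sum.inl i) • u i x := by
    intro x
    simp [Fintype.sum_sum_type, hJ, hv]
  have hsc : Continuous (fun x => ∑ i, n (Sum.inl i) • u i x) :=
    continuous_finsetSum _ fun i _ => (huc i).zsmul _
  -- The surviving combination is continuous on all of `X`, so lifting again with no exceptional
  -- points gives a global lift; the earlier one is continuous only off `Q`.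
  obtain ⟨l', hl', -, hlf'⟩ := exists_lift_rel hGc (Q := ∅) finite_empty (by simp) hdisc
    (by simp) (f := fun x => ∑ i, n (Sum.inl i) • u i x - θ x)
    (hsc.sub (Real.Angle.continuous_coe.comp hθ)).continuousOn
    (fun x hx => by simp [hθG x hx, hθ₀v x hx, hs])
  have hI := hui (fun i => n (Sum.inl i)) ⟨fun x => l' x + θ x,
    (by simpa using hl' : Continuous l').add hθ, fun x => by
      rw [Real.Angle.coe_add, hlf' x (by simp), sub_add_cancel]⟩
  apply hn
  ext (i | j)
  · exact congrFun hI i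
  · exact hJ j

end Count

/-! ### Components in the punctured and in the closed surface -/

section Components

variable {X : Type*} [TopologicalSpace X]

/-- Every point has arbitrarily small open neighbourhoods that stay connected when the point is
removed. -/
def LocallyPuncturedConnected (X : Type*) [TopologicalSpace X] : Prop :=
  ∀ p : X, ∀ N ∈ 𝓝 p, ∃ M, IsOpen M ∧ p ∈ M ∧ M ⊆ N ∧ IsConnected (M \ {p})

lemma LocallyPuncturedConnected.neBot (h : LocallyPuncturedConnected X) (p : X) :
    (𝓝[≠] p).NeBot := by
  rw [← mem_closure_iff_nhdsWithin_neBot, mem_closure_iff_nhds]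
  intro N hN
  obtain ⟨M, -, -, hMN, hM⟩ := h p N hN
  obtain ⟨x, hx⟩ := hM.nonempty
  exact ⟨x, hMN hx.1, hx.2⟩

lemma LocallyPuncturedConnected.locallyConnectedSpace (h : LocallyPuncturedConnected X) :
    LocallyConnectedSpace X := by
  rw [locallyConnectedSpace_iff_subsets_isOpen_isConnected]
  intro p N hN
  obtain ⟨M, hMo, hpM, hMN, hM⟩ := h p N hN
  refine ⟨M, hMN, hMo, hpM, hM.subset_closure sdiff_subset fun x hx => ?_⟩
  by_cases hxp : x = p
  · subst hxp
    have := h.neBot x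
    rw [mem_closure_iff_frequently]
    have h1 : ∀ᶠ y in 𝓝[≠] x, y ∈ M \ {x} := by
      filter_upwards [self_mem_nhdsWithin, mem_nhdsWithin_of_mem_nhds (hMo.mem_nhds hpM)]
        with y h1 h2 using ⟨h2, h1⟩
    exact h1.frequently.filter_mono nhdsWithin_le_nhds
  · exact subset_closure ⟨hx, hxp⟩

/-- In a separation of `W \ {p}`, the connected set `M \ {p}` lies on one side. Adding `M`, and with
it `p`, to that side would separate `W`. -/
lemma LocallyPuncturedConnected.isPreconnected_sdiff_singleton [T1Space X]
    (h : LocallyPuncturedConnected X) {W : Set X} (hWo : IsOpen W) (hW : IsPreconnected W) (p : X) :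
    IsPreconnected (W \ {p}) := by
  by_cases hp : p ∈ W
  swap
  · rwa [sdiff_singleton_eq_self hp]
  obtain ⟨M, hMo, hpM, hMW, hM⟩ := h p W (hWo.mem_nhds hp)
  have hWp : IsOpen (W \ {p}) := hWo.sdiff isClosed_singleton
  have aux : ∀ u v : Set X, IsOpen u → IsOpen v → W \ {p} ⊆ u ∪ v → (W \ {p} ∩ v).Nonempty →
      M \ {p} ⊆ u → (W \ {p} ∩ (u ∩ v)).Nonempty := by
    intro u v hu hv huv hvn hMu
    obtain ⟨x, hxW, hx1, hx2⟩ := hW ((W \ {p} ∩ u) ∪ M) (W \ {p} ∩ v)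
      ((hWp.inter hu).union hMo) (hWp.inter hv) (by
        intro x hx
        by_cases hxp : x = p
        · exact Or.inl (Or.inr (hxp ▸ hpM))
        · rcases huv ⟨hx, hxp⟩ with h | h
          · exact Or.inl (Or.inl ⟨⟨hx, hxp⟩, h⟩)
          · exact Or.inr ⟨⟨hx, hxp⟩, h⟩) ⟨p, hp, Or.inr hpM⟩
      (by
        obtain ⟨y, hy, hyv⟩ := hvn
        exact ⟨y, hy.1, hy, hyv⟩)
    refine ⟨x, hx2.1, ?_, hx2.2⟩
    rcases hx1 with h | h
    · exact h.2
    · exact hMu ⟨h, hx2.1.2⟩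
  intro u v hu hv huv hun hvn
  by_cases hne : ((M \ {p}) ∩ (u ∩ v)).Nonempty
  · obtain ⟨x, hx, hxuv⟩ := hne
    exact ⟨x, ⟨hMW hx.1, hx.2⟩, hxuv⟩
  rw [not_nonempty_iff_eq_empty] at hne
  rcases isPreconnected_iff_subset_of_disjoint.1 hM.isPreconnected u v hu hv
    ((sdiff_subset_sdiff_left hMW).trans huv) hne with h | h
  · exact aux u v hu hv huv hvn h
  · rw [inter_comm u v]
    exact aux v u hv hu (by rwa [union_comm]) hun h

lemma LocallyPuncturedConnected.isPreconnected_sdiff_finite [T1Space X]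
    (h : LocallyPuncturedConnected X) {W : Set X} (hWo : IsOpen W) (hW : IsPreconnected W)
    {P : Set X} (hP : P.Finite) : IsPreconnected (W \ P) := by
  induction P, hP using Set.Finite.induction_on with
  | empty => simpa using hW
  | @insert p P _ hP ih =>
    have : W \ insert p P = (W \ P) \ {p} := by
      ext x
      simp only [Set.mem_sdiff, mem_insert_iff, mem_singleton_iff]
      tauto
    rw [this]
    exact h.isPreconnected_sdiff_singleton (hWo.sdiff hP.isClosed) ih p

lemma IsOpenDisc.isPreconnected {V : Set X} (hV : IsOpenDisc V) : IsPreconnected V := by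
  obtain ⟨φ⟩ := hV
  have h1 : PreconnectedSpace (Metric.ball (0 : ℂ) 1) :=
    isPreconnected_iff_preconnectedSpace.1 Metric.isPreconnected_ball
  rw [isPreconnected_iff_preconnectedSpace]
  exact φ.symm.surjective.denseRange.preconnectedSpace φ.symm.continuous

/-- An open disc in a connected compact Hausdorff space has just one end: if it contains a punctured
neighbourhood of a point `p` outside, then `p` is the only point outside. -/
lemma IsOpenDisc.insert_eq_univ [CompactSpace X] [T2Space X] [PreconnectedSpace X] {V : Set X}
    (hV : IsOpenDisc V) (hVo : IsOpen V) {p : X} (hp : p ∉ V) [(𝓝[≠] p).NeBot]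
    (hpV : ∀ᶠ x in 𝓝[≠] p, x ∈ V) : insert p V = univ := by
  obtain ⟨φ₀⟩ := hV
  set φ : V ≃ₜ ℂ := φ₀.trans Homeomorph.unitBall.symm
  have hins : insert p V ∈ 𝓝 p := insert_mem_nhds_iff.2 hpV
  obtain ⟨D, hD, hDV, hDc⟩ := local_compact_nhds hins
  have hpO : p ∈ interior D := mem_interior_iff_mem_nhds.2 hD
  have hC : IsCompact (D \ interior D) := hDc.diff isOpen_interior
  have hCV : D \ interior D ⊆ V := by
    intro x hx
    rcases hDV hx.1 with rfl | h
    · exact absurd hpO hx.2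
    · exact h
  obtain ⟨R, hR, hCR⟩ : ∃ R > 0, φ '' (Subtype.val ⁻¹' (D \ interior D)) ⊆
      Metric.closedBall 0 R := by
    have hc : IsCompact (φ '' (Subtype.val ⁻¹' (D \ interior D))) := by
      apply IsCompact.image _ φ.continuous
      rw [Subtype.isCompact_iff, Subtype.image_preimage_coe, inter_eq_right.2 hCV]
      exact hC
    obtain ⟨R, hR⟩ := hc.isBounded.subset_closedBall 0
    exact ⟨max R 1, by positivity, hR.trans (Metric.closedBall_subset_closedBall (le_max_left _ _))⟩
  set K : Set X := Subtype.val '' (φ.symm '' Metric.closedBall 0 R) with hK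
  have hKc : IsCompact K :=
    ((isCompact_closedBall 0 R).image φ.symm.continuous).image continuous_subtype_val
  have hKV : K ⊆ V := by
    rintro _ ⟨x, -, rfl⟩
    exact x.2
  have hVK : ∀ x (hx : x ∈ V), x ∉ K → R < ‖φ ⟨x, hx⟩‖ := by
    intro x hx hxK
    by_contra hcon
    exact hxK ⟨⟨x, hx⟩, ⟨φ ⟨x, hx⟩, by simpa using hcon, by simp⟩, rfl⟩
  have hval : Continuous fun z => (φ.symm z : X) := continuous_subtype_val.comp φ.symm.continuous
  -- The exterior of the large disc is connected and misses `D \ interior D`, so it lies entirely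
  -- outside `D` or entirely in its interior.
  rcases isPreconnected_iff_subset_of_disjoint.1 (isPreconnected_norm_gt hR)
    ((fun z => (φ.symm z : X)) ⁻¹' Dᶜ) ((fun z => (φ.symm z : X)) ⁻¹' interior D)
    (hDc.isClosed.isOpen_compl.preimage hval) (isOpen_interior.preimage hval)
    (by
      intro z hz
      by_contra hcon
      simp only [mem_union, mem_preimage, mem_compl_iff, not_or, not_not] at hcon
      have := hCR ⟨φ.symm z, hcon, φ.apply_symm_apply z⟩
      rw [mem_closedBall_zero_iff] at this
      exact absurd hz (not_lt.2 this))
    (by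
      ext z
      simp only [mem_inter_iff, mem_preimage, mem_compl_iff, mem_empty_iff_false, iff_false]
      rintro ⟨-, h1, h2⟩
      exact h1 (interior_subset h2)) with h | h
  -- Here points of `V` near `p` lie in the closed set `K`, which forces `p ∈ K ⊆ V`.
  · exfalso
    have hfr : ∃ᶠ x in 𝓝 p, x ∈ K := by
      have : ∀ᶠ x in 𝓝[≠] p, x ∈ K := by
        filter_upwards [hpV, mem_nhdsWithin_of_mem_nhds hD] with x hx hxD
        by_contra hxK
        have := h (hVK x hx hxK)
        simp only [mem_preimage, Homeomorph.symm_apply_apply] at this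
        exact this hxD
      exact this.frequently.filter_mono nhdsWithin_le_nhds
    exact hp (hKV (hKc.isClosed.closure_eq ▸ mem_closure_iff_frequently.2 hfr))
  -- Here `insert p V` is a union of two compact sets. It is also open, so connectedness makes it
  -- everything.
  · have heq : insert p V = K ∪ D := by
      apply subset_antisymm
      · rintro x (rfl | hx)
        · exact Or.inr (interior_subset hpO)
        · by_cases hxK : x ∈ K
          · exact Or.inl hxK
          · have := h (hVK x hx hxK)
            simp only [mem_preimage, Homeomorph.symm_apply_apply] at this
            exact Or.inr (interior_subset this)
      · exact union_subset (hKV.trans (subset_insert _ _)) hDV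
    refine IsClopen.eq_univ ⟨?_, ?_⟩ (insert_nonempty _ _)
    · rw [heq]
      exact hKc.isClosed.union hDc.isClosed
    · rw [isOpen_iff_mem_nhds]
      rintro x (rfl | hx)
      · exact hins
      · exact mem_of_superset (hVo.mem_nhds hx) (subset_insert _ _)

lemma isOpenDisc_image_val {P : Set X} {U : Set P} (hU : IsOpenDisc U) :
    IsOpenDisc (Subtype.val '' U : Set X) := by
  obtain ⟨φ⟩ := hU
  exact ⟨(IsEmbedding.subtypeVal.homeomorphImage U).symm.trans φ⟩

/-- If the components of the complement of `G'` in a punctured surface are discs and once-punctured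
discs, then the components of its complement in the closed surface are discs, with at most one
puncture each. -/
lemma isOpenDisc_component_of_punctured [CompactSpace X] [T2Space X] [PreconnectedSpace X]
    (hX : LocallyPuncturedConnected X) {P : Finset X} {G' : Set (Punctured P)} (hne : G'.Nonempty)
    (hG : IsClosed (Subtype.val '' G' : Set X))
    (hfill : ∀ x ∈ G'ᶜ, IsOpenDisc (connectedComponentIn G'ᶜ x) ∨
      IsOncePuncturedDisc (connectedComponentIn G'ᶜ x)) {x : X}
    (hx : x ∈ (Subtype.val '' G' : Set X)ᶜ) :
    IsOpenDisc (connectedComponentIn (Subtype.val '' G' : Set X)ᶜ x) ∧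
      (connectedComponentIn (Subtype.val '' G' : Set X)ᶜ x ∩ P).Subsingleton := by
  have := hX.locallyConnectedSpace
  have hnb := hX.neBot
  set G : Set X := Subtype.val '' G' with hGdef
  set W := connectedComponentIn Gᶜ x with hW
  have hWo : IsOpen W := hG.isOpen_compl.connectedComponentIn
  have hWG : W ⊆ Gᶜ := connectedComponentIn_subset _ _
  have hPf : (P : Set X).Finite := P.finite_toSet
  obtain ⟨g, hg⟩ := hne
  have hgG : (g : X) ∈ G := ⟨g, hg, rfl⟩
  have hgP : (g : X) ∉ P := g.2
  have hWP : IsPreconnected (W \ P) :=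
    hX.isPreconnected_sdiff_finite hWo isPreconnected_connectedComponentIn hPf
  have hxW : x ∈ W := mem_connectedComponentIn hx
  obtain ⟨y, hyW, hyP⟩ : (W \ P).Nonempty := by
    have h1 : ∀ᶠ z in 𝓝[≠] x, z ∈ W \ P := by
      have h2 : ((P : Set X) \ {x})ᶜ ∈ 𝓝 x :=
        (hPf.sdiff).isClosed.isOpen_compl.mem_nhds (by simp)
      filter_upwards [self_mem_nhdsWithin, mem_nhdsWithin_of_mem_nhds h2,
        mem_nhdsWithin_of_mem_nhds (hWo.mem_nhds hxW)] with z h1 h2 h3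
      exact ⟨h3, fun h => h2 ⟨h, h1⟩⟩
    exact h1.exists
  have hWy : W = connectedComponentIn Gᶜ y := connectedComponentIn_eq hyW
  set y' : Punctured P := ⟨y, hyP⟩ with hy'
  have hyG' : y' ∈ G'ᶜ := fun h => hWG hyW ⟨y', h, rfl⟩
  have himage : (Subtype.val '' connectedComponentIn G'ᶜ y' : Set X) = W \ P := by
    apply subset_antisymm
    · apply subset_sdiff.2
      constructor
      · rw [hWy]
        apply (isPreconnected_connectedComponentIn.image _
          continuous_subtype_val.continuousOn).subset_connectedComponentIn
        · exact ⟨y', mem_connectedComponentIn hyG', rfl⟩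
        · rintro _ ⟨z, hz, rfl⟩ ⟨z', hz', hzz'⟩
          have : z' = z := Subtype.ext hzz'
          exact connectedComponentIn_subset _ _ hz (this ▸ hz')
      · rw [disjoint_left]
        rintro _ ⟨z, -, rfl⟩
        exact z.2
    · intro z hz
      have hpre : IsPreconnected (Subtype.val ⁻¹' (W \ P) : Set (Punctured P)) := by
        refine (IsInducing.isPreconnected_image (f := fun z : Punctured P => (z : X))
          IsInducing.subtypeVal).1 ?_
        have : (fun z : Punctured P => (z : X)) '' (Subtype.val ⁻¹' (W \ P)) = W \ P := by
          ext w
          exact ⟨by rintro ⟨w, hw, rfl⟩; exact hw, fun hw => ⟨⟨w, hw.2⟩, hw, rfl⟩⟩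
        rwa [this]
      refine ⟨⟨z, hz.2⟩, hpre.subset_connectedComponentIn ⟨hyW, hyP⟩ ?_ hz, rfl⟩
      intro w hw hwG
      exact hWG hw.1 ⟨w, hwG, rfl⟩
  -- A puncture of `W` missing from `V` would be isolated in the complement of `V`, so `V` and that
  -- puncture would fill `X`. But the point `g` of the curves lies in neither.
  have hend : ∀ V : Set X, IsOpenDisc V → W \ P ⊆ V → V ⊆ W → ∀ q ∈ W ∩ P, q ∈ V := by
    intro V hV hPV hVW q hq
    by_contra hqV
    have hVo : IsOpen V := by
      have : V = W \ (P \ V) := by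
        ext z
        constructor
        · exact fun hz => ⟨hVW hz, fun h => h.2 hz⟩
        · intro hz
          by_contra hzV
          exact hzV (hPV ⟨hz.1, fun h => hz.2 ⟨h, hzV⟩⟩)
      rw [this]
      exact hWo.sdiff hPf.sdiff.isClosed
    have hev : ∀ᶠ z in 𝓝[≠] q, z ∈ V := by
      have h2 : ((P : Set X) \ {q})ᶜ ∈ 𝓝 q :=
        (hPf.sdiff).isClosed.isOpen_compl.mem_nhds (by simp)
      filter_upwards [self_mem_nhdsWithin, mem_nhdsWithin_of_mem_nhds h2,
        mem_nhdsWithin_of_mem_nhds (hWo.mem_nhds hq.1)] with z h1 h2 h3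
      exact hPV ⟨h3, fun h => h2 ⟨h, h1⟩⟩
    have huniv := hV.insert_eq_univ hVo hqV hev
    have : (g : X) ∈ insert q V := huniv ▸ mem_univ _
    rcases this with h | h
    · exact hgP (h ▸ hq.2)
    · exact hWG (hVW h) hgG
  rcases hfill y' hyG' with h | ⟨p, hp, h⟩
  · have hd : IsOpenDisc (W \ P) := himage ▸ isOpenDisc_image_val h
    have hemp : ∀ q ∈ W ∩ P, False := fun q hq =>
      (hend _ hd subset_rfl sdiff_subset q hq).2 hq.2
    have hWeq : W \ P = W := by
      ext z
      exact ⟨fun h => h.1, fun hz => ⟨hz, fun hzP => hemp z ⟨hz, hzP⟩⟩⟩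
    exact ⟨hWeq ▸ hd, fun q hq => (hemp q hq).elim⟩
  · rw [himage] at h
    have hpG : p ∉ G := by
      rintro ⟨z, -, rfl⟩
      exact z.2 hp
    have hsubW : insert p (W \ P) ⊆ W := by
      conv_rhs => rw [hWy]
      apply h.isPreconnected.subset_connectedComponentIn (mem_insert_of_mem _ ⟨hyW, hyP⟩)
      rintro z (rfl | hz)
      · exact hpG
      · exact hWG hz.1
    have hall : ∀ q ∈ W ∩ P, q = p := by
      intro q hq
      rcases hend _ h (subset_insert _ _) hsubW q hq with h | h
      · exact h
      · exact absurd hq.2 h.2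
    have hWeq : insert p (W \ P) = W := by
      apply subset_antisymm hsubW
      intro z hz
      by_cases hzP : z ∈ P
      · exact Or.inl (hall z ⟨hz, hzP⟩)
      · exact Or.inr ⟨hz, hzP⟩
    exact ⟨hWeq ▸ h, fun q hq r hr => (hall q hq).trans (hall r hr).symm⟩

end Components

/-! ### The planar disc with holes -/

section Region

/-- The radius of the outer boundary circle. -/
def outerRadius (g : ℕ) : ℝ := 3 * g + 1

/-- The centre of the `k`-th hole. -/
noncomputable def holeCenter (k : ℕ) : ℂ := ((3 * k : ℝ) : ℂ)

/-- The closed disc with `g` holes over which the standard surface lies. -/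
def holedDisc (g : ℕ) : Set ℂ :=
  {w | ‖w‖ ≤ outerRadius g ∧ ∀ k < g, 1 ≤ ‖w - holeCenter k‖}

/-- The defining polynomial of the surface as a function of a complex variable. -/
noncomputable def discFun (g : ℕ) (w : ℂ) : ℝ := holedDiscPoly g w.re w.im

lemma outerRadius_pos (g : ℕ) : 0 < outerRadius g := by
  unfold outerRadius; positivity

lemma discFun_eq (g : ℕ) (w : ℂ) : discFun g w =
    (outerRadius g ^ 2 - ‖w‖ ^ 2) * ∏ k ∈ Finset.range g, (‖w - holeCenter k‖ ^ 2 - 1) := by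
  unfold discFun holedDiscPoly outerRadius
  congr 1
  · rw [← Complex.normSq_eq_norm_sq, Complex.normSq_apply]; ring
  · refine Finset.prod_congr rfl fun k _ => ?_
    rw [← Complex.normSq_eq_norm_sq, Complex.normSq_apply]
    simp [holeCenter]
    ring

lemma continuous_discFun (g : ℕ) : Continuous (discFun g) := by
  unfold discFun holedDiscPoly
  fun_prop

lemma norm_holeCenter (k : ℕ) : ‖holeCenter k‖ = 3 * k := by
  unfold holeCenter
  rw [Complex.norm_real, Real.norm_of_nonneg (by positivity)]

lemma three_le_norm_holeCenter_sub {j k : ℕ} (h : j ≠ k) :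
    3 ≤ ‖holeCenter j - holeCenter k‖ := by
  unfold holeCenter
  rw [← Complex.ofReal_sub, Complex.norm_real, Real.norm_eq_abs, ← mul_sub, abs_mul, abs_of_pos
    (by norm_num : (0 : ℝ) < 3)]
  have : (1 : ℝ) ≤ |(j : ℝ) - k| := by
    have h1 : (1 : ℤ) ≤ |(j : ℤ) - k| := Int.one_le_abs (sub_ne_zero.2 (by exact_mod_cast h))
    exact_mod_cast h1
  linarith

/-- For `k ≤ g - 1` the centre has norm `3k ≤ outerRadius g - 4`, so holes stay well away from the
outer circle. -/
lemma le_norm_sub_holeCenter {g k : ℕ} (hk : k < g) (w : ℂ) :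
    ‖w‖ - outerRadius g + 4 ≤ ‖w - holeCenter k‖ := by
  have h1 := norm_sub_norm_le w (holeCenter k)
  rw [norm_holeCenter] at h1
  have : (k : ℝ) + 1 ≤ g := by exact_mod_cast hk
  unfold outerRadius
  linarith

lemma le_norm_sub_holeCenter_of_ne {j k : ℕ} (h : j ≠ k) (w : ℂ) :
    3 - ‖w - holeCenter k‖ ≤ ‖w - holeCenter j‖ := by
  have h1 := three_le_norm_holeCenter_sub h
  have h2 := norm_sub_le (w - holeCenter k) (w - holeCenter j)
  rw [sub_sub_sub_cancel_left] at h2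
  linarith

lemma discFun_nonneg {g : ℕ} {w : ℂ} (hw : w ∈ holedDisc g) : 0 ≤ discFun g w := by
  rw [discFun_eq]
  apply mul_nonneg
  · have := pow_le_pow_left₀ (norm_nonneg w) hw.1 2
    linarith
  · apply Finset.prod_nonneg
    intro k hk
    have := one_le_pow₀ (n := 2) (hw.2 k (Finset.mem_range.1 hk))
    linarith

/-- The boundary circles are far apart, so outside the holed disc exactly one factor is negative and
the others are positive. -/
lemma mem_holedDisc_of_discFun_nonneg {g : ℕ} {w : ℂ} (hw : 0 ≤ discFun g w) :
    w ∈ holedDisc g := by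
  rw [discFun_eq] at hw
  have hR : ‖w‖ ≤ outerRadius g := by
    by_contra! hcon
    refine absurd hw (not_le.2 (mul_neg_of_neg_of_pos ?_ (Finset.prod_pos fun k hk => ?_)))
    · have := pow_lt_pow_left₀ hcon (outerRadius_pos g).le two_ne_zero
      linarith
    · have := le_norm_sub_holeCenter (Finset.mem_range.1 hk) w
      nlinarith
  refine ⟨hR, fun k hk => ?_⟩
  by_contra! hcon
  refine absurd hw (not_le.2 (mul_neg_of_pos_of_neg ?_ ?_))
  · have := le_norm_sub_holeCenter hk w
    have h2 : ‖w‖ < outerRadius g := by linarith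
    have := pow_lt_pow_left₀ h2 (norm_nonneg w) two_ne_zero
    linarith
  · rw [← Finset.mul_prod_erase _ _ (Finset.mem_range.2 hk)]
    apply mul_neg_of_neg_of_pos
    · have := pow_lt_one₀ (norm_nonneg _) hcon two_ne_zero
      linarith
    · refine Finset.prod_pos fun j hj => ?_
      have := le_norm_sub_holeCenter_of_ne (Finset.ne_of_mem_erase hj) w
      nlinarith

lemma discFun_eq_zero_iff {g : ℕ} {w : ℂ} :
    discFun g w = 0 ↔ ‖w‖ = outerRadius g ∨ ∃ k < g, ‖w - holeCenter k‖ = 1 := by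
  rw [discFun_eq, mul_eq_zero, Finset.prod_eq_zero_iff]
  refine or_congr ?_ (exists_congr fun k => and_congr Finset.mem_range ?_)
  · rw [sub_eq_zero, eq_comm, pow_left_inj₀ (norm_nonneg _) (outerRadius_pos g).le two_ne_zero]
  · rw [sub_eq_zero, pow_eq_one_iff_of_nonneg (norm_nonneg _) two_ne_zero]

/-- At a boundary point of the holed disc the defining function has a nonvanishing derivative, in
the direction of a vector that points inwards. -/
lemma exists_hasDerivAt_discFun {g : ℕ} {w : ℂ} (hw : discFun g w = 0) :
    ∃ (v : ℂ) (d : ℝ), 0 < d ∧ HasDerivAt (fun t : ℝ => discFun g (w + t * v)) d 0 := by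
  have hD : w ∈ holedDisc g := mem_holedDisc_of_discFun_nonneg hw.ge
  have key : ∀ (v : ℂ) (s : Finset ℕ), DifferentiableAt ℝ
      (fun t : ℝ => ∏ k ∈ s, (‖w + t * v - holeCenter k‖ ^ 2 - 1)) 0 := by
    intro v s
    simp_rw [← Complex.normSq_eq_norm_sq, Complex.normSq_apply]
    simp only [Complex.sub_re, Complex.add_re, Complex.mul_re, Complex.ofReal_re,
      Complex.ofReal_im, Complex.sub_im, Complex.add_im, Complex.mul_im]
    fun_prop
  rcases discFun_eq_zero_iff.1 hw with h | ⟨k, hk, h⟩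
  -- Along the inward radius the vanishing factor becomes `R² (1 - (1 - t)²)`, with derivative `2R²`
  -- at `0`. At a hole, the outward radius gives `(1 + t)² - 1`, with derivative `2`.
  · refine ⟨-w, 2 * outerRadius g ^ 2 * ∏ k ∈ Finset.range g, (‖w - holeCenter k‖ ^ 2 - 1), ?_, ?_⟩
    · apply mul_pos
      · have := outerRadius_pos g
        positivity
      · refine Finset.prod_pos fun k hk => ?_
        have := le_norm_sub_holeCenter (Finset.mem_range.1 hk) w
        nlinarith
    · have h1 : HasDerivAt (fun t : ℝ => outerRadius g ^ 2 * (1 - (1 - t) ^ 2))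
          (2 * outerRadius g ^ 2) 0 := by
        have := (((hasDerivAt_id (0 : ℝ)).const_sub 1).pow 2).const_sub 1 |>.const_mul
          (outerRadius g ^ 2)
        refine this.congr_deriv ?_
        simp [mul_comm]
      have h2 := h1.mul (key (-w) (Finset.range g)).hasDerivAt
      refine (h2.congr_deriv ?_).congr_of_eventuallyEq (Eventually.of_forall fun t => ?_)
      · simp
      · change discFun g (w + t * -w) = _
        rw [Pi.mul_apply, discFun_eq]
        congr 1
        have : w + t * -w = ((1 - t : ℝ) : ℂ) * w := by push_cast; ring
        rw [this, norm_mul, Complex.norm_real, Real.norm_eq_abs, mul_pow, sq_abs, h]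
        ring
  · have hpos : 0 < (outerRadius g ^ 2 - ‖w‖ ^ 2) *
        ∏ j ∈ (Finset.range g).erase k, (‖w - holeCenter j‖ ^ 2 - 1) := by
      apply mul_pos
      · have := le_norm_sub_holeCenter hk w
        have h2 : ‖w‖ < outerRadius g := by linarith
        have := pow_lt_pow_left₀ h2 (norm_nonneg w) two_ne_zero
        linarith
      · refine Finset.prod_pos fun j hj => ?_
        have := le_norm_sub_holeCenter_of_ne (Finset.ne_of_mem_erase hj) w
        nlinarith
    refine ⟨w - holeCenter k, 2 * ((outerRadius g ^ 2 - ‖w‖ ^ 2) *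
        ∏ j ∈ (Finset.range g).erase k, (‖w - holeCenter j‖ ^ 2 - 1)), by linarith, ?_⟩
    have h1 : HasDerivAt (fun t : ℝ => (1 + t) ^ 2 - 1) 2 0 := by
      have := (((hasDerivAt_id (0 : ℝ)).const_add 1).pow 2).sub_const 1
      refine this.congr_deriv ?_
      simp
    have h3 : DifferentiableAt ℝ (fun t : ℝ =>
        (outerRadius g ^ 2 - ‖w + t * (w - holeCenter k)‖ ^ 2)) 0 := by
      simp_rw [← Complex.normSq_eq_norm_sq, Complex.normSq_apply]
      simp only [Complex.add_re, Complex.mul_re, Complex.ofReal_re,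
        Complex.ofReal_im, Complex.add_im, Complex.mul_im]
      fun_prop
    have h2 := h1.mul (h3.mul (key (w - holeCenter k) ((Finset.range g).erase k))).hasDerivAt
    refine (h2.congr_deriv ?_).congr_of_eventuallyEq (Eventually.of_forall fun t => ?_)
    · simp
    · change discFun g (w + t * (w - holeCenter k)) = _
      rw [Pi.mul_apply, Pi.mul_apply, discFun_eq,
        ← Finset.mul_prod_erase _ _ (Finset.mem_range.2 hk)]
      have : w + t * (w - holeCenter k) - holeCenter k =
          ((1 + t : ℝ) : ℂ) * (w - holeCenter k) := by push_cast; ring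
      rw [this, norm_mul, Complex.norm_real, Real.norm_eq_abs, mul_pow, sq_abs, h]
      ring

lemma isClosed_holedDisc (g : ℕ) : IsClosed (holedDisc g) := by
  have : holedDisc g = {w | 0 ≤ discFun g w} := by
    ext w
    exact ⟨discFun_nonneg, mem_holedDisc_of_discFun_nonneg⟩
  rw [this]
  exact isClosed_le continuous_const (continuous_discFun g)

lemma isCompact_holedDisc (g : ℕ) : IsCompact (holedDisc g) :=
  (isCompact_closedBall 0 (outerRadius g)).of_isClosed_subset (isClosed_holedDisc g)
    fun w hw => by simpa using hw.1

lemma sphere_subset_holedDisc (g : ℕ) : Metric.sphere 0 (outerRadius g) ⊆ holedDisc g := by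
  intro w hw
  rw [mem_sphere_zero_iff_norm] at hw
  exact mem_holedDisc_of_discFun_nonneg (discFun_eq_zero_iff.2 (Or.inl hw)).ge

lemma norm_sq_mk (x y : ℝ) : ‖(⟨x, y⟩ : ℂ)‖ ^ 2 = x ^ 2 + y ^ 2 := by
  rw [← Complex.normSq_eq_norm_sq, Complex.normSq_mk]; ring

/-- Moving away from the real axis inside the outer circle does not leave the holed disc. -/
lemma mem_holedDisc_of_vertical {g : ℕ} {x y t : ℝ} (h : (⟨x, y⟩ : ℂ) ∈ holedDisc g)
    (hy : y ^ 2 ≤ t ^ 2) (ht : x ^ 2 + t ^ 2 ≤ outerRadius g ^ 2) : (⟨x, t⟩ : ℂ) ∈ holedDisc g := by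
  constructor
  · rw [← pow_le_pow_iff_left₀ (norm_nonneg _) (outerRadius_pos g).le two_ne_zero, norm_sq_mk]
    exact ht
  · intro k hk
    have h1 := one_le_pow₀ (n := 2) (h.2 k hk)
    rw [← one_le_sq_iff₀ (norm_nonneg _)]
    have e : ∀ s : ℝ, (⟨x, s⟩ : ℂ) - holeCenter k = ⟨x - 3 * k, s⟩ := by
      intro s
      apply Complex.ext <;> simp [holeCenter]
    rw [e, norm_sq_mk] at h1 ⊢
    linarith

/-- The holes are centred on the real axis, so a vertical segment leading away from the axis joins
any point to the connected outer circle. -/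
lemma isPreconnected_holedDisc (g : ℕ) : IsPreconnected (holedDisc g) := by
  have hsph : IsPreconnected (Metric.sphere (0 : ℂ) (outerRadius g)) :=
    isPreconnected_sphere (by rw [Complex.rank_real_complex]; exact Nat.one_lt_ofNat) _ _
  have hR : ((outerRadius g : ℝ) : ℂ) ∈ Metric.sphere (0 : ℂ) (outerRadius g) := by
    simp [abs_of_pos (outerRadius_pos g)]
  apply isPreconnected_of_forall ((outerRadius g : ℝ) : ℂ)
  rintro ⟨x, y⟩ hw
  have hw1 := pow_le_pow_left₀ (norm_nonneg _) hw.1 2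
  rw [norm_sq_mk] at hw1
  obtain ⟨ε, hε, hεy⟩ : ∃ ε : ℝ, ε ^ 2 = 1 ∧ y = ε * |y| := by
    rcases le_total 0 y with h | h
    · exact ⟨1, by norm_num, by rw [abs_of_nonneg h, one_mul]⟩
    · exact ⟨-1, by norm_num, by rw [abs_of_nonpos h]; ring⟩
  set Y := √(outerRadius g ^ 2 - x ^ 2) with hY
  have hY2 : Y ^ 2 = outerRadius g ^ 2 - x ^ 2 := Real.sq_sqrt (by nlinarith [sq_nonneg y])
  have hyY : |y| ≤ Y := by
    apply Real.le_sqrt_of_sq_le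
    rw [sq_abs]
    linarith
  set path : ℝ → ℂ := fun t => ⟨x, ε * t⟩ with hpath
  have hpc : Continuous path := by
    have : path = fun t => (x : ℂ) + (ε * t : ℝ) * Complex.I := by
      ext t
      apply Complex.ext <;> simp [hpath]
    rw [this]
    fun_prop
  have hYs : path Y ∈ Metric.sphere (0 : ℂ) (outerRadius g) := by
    rw [mem_sphere_zero_iff_norm,
      ← pow_left_inj₀ (norm_nonneg _) (outerRadius_pos g).le two_ne_zero, norm_sq_mk, mul_pow, hε,
      hY2]
    ring
  refine ⟨path '' Icc |y| Y ∪ Metric.sphere 0 (outerRadius g), ?_, Or.inr hR, Or.inl ?_, ?_⟩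
  · apply union_subset _ (sphere_subset_holedDisc g)
    rintro _ ⟨t, ⟨ht1, ht2⟩, rfl⟩
    apply mem_holedDisc_of_vertical hw
    · rw [mul_pow, hε, one_mul, ← sq_abs y]
      exact pow_le_pow_left₀ (abs_nonneg y) ht1 2
    · rw [mul_pow, hε, one_mul]
      have := pow_le_pow_left₀ ((abs_nonneg y).trans ht1) ht2 2
      linarith
  · exact ⟨|y|, ⟨le_rfl, hyY⟩, by simp only [hpath]; rw [← hεy]⟩
  · exact (isPreconnected_Icc.image _ hpc.continuousOn).union (path Y)
      ⟨Y, ⟨hyY, le_rfl⟩, rfl⟩ hYs hsph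

end Region

/-! ### Regular level sets near a point -/

section LevelSet

variable {E : Type*} [NormedAddCommGroup E] [NormedSpace ℝ E]

/-- Polar coordinates present the punctured ball as the image of an interval times the unit sphere,
which is connected in real dimension at least two. -/
lemma isConnected_ball_sdiff_center (hE : 1 < Module.rank ℝ E) {ε : ℝ} (hε : 0 < ε) :
    IsConnected (Metric.ball (0 : E) ε \ {0}) := by
  have heq : Metric.ball (0 : E) ε \ {0} =
      (fun p : ℝ × E => p.1 • p.2) '' (Ioo 0 ε ×ˢ Metric.sphere (0 : E) 1) := by
    ext x
    constructor
    · rintro ⟨hx, hx0⟩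
      have hx0 : x ≠ 0 := hx0
      have hn : 0 < ‖x‖ := norm_pos_iff.2 hx0
      refine ⟨(‖x‖, ‖x‖⁻¹ • x), ⟨⟨hn, by simpa using hx⟩, ?_⟩, ?_⟩
      · simp [norm_smul, hn.ne']
      · simp [smul_smul, hn.ne']
    · rintro ⟨⟨r, y⟩, ⟨⟨hr1, hr2⟩, hy⟩, rfl⟩
      have hy : ‖y‖ = 1 := by simpa using hy
      refine ⟨by simpa [norm_smul, hy, abs_of_pos hr1] using hr2, ?_⟩
      have : y ≠ 0 := by
        rintro rfl
        simp at hy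
      simpa [this] using hr1.ne'
  rw [heq]
  apply IsConnected.image _ _ (by fun_prop)
  exact (isConnected_Ioo hε).prod (isConnected_sphere hE 0 zero_le_one)

/-- Near a regular point, the level set of a function on a space of dimension at least three stays
connected when the point is removed. -/
lemma exists_nhds_isConnected_level_sdiff [FiniteDimensional ℝ E] (hE : 3 ≤ Module.finrank ℝ E)
    {Φ : E → ℝ} {Φ' : E →L[ℝ] ℝ} {a : E} (hΦ : HasStrictFDerivAt Φ Φ' a) (hΦ' : Φ' ≠ 0)
    (ha : Φ a = 0) {N : Set E} (hN : N ∈ 𝓝 a) :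
    ∃ M, IsOpen M ∧ a ∈ M ∧ M ⊆ N ∧ IsConnected ((M ∩ {x | Φ x = 0}) \ {a}) := by
  have := FiniteDimensional.complete ℝ E
  have hsurj : Φ'.range = ⊤ := by
    rw [LinearMap.range_eq_top]
    apply LinearMap.surjective
    intro h
    apply hΦ'
    ext x
    exact LinearMap.congr_fun h x
  have hrank : 1 < Module.rank ℝ Φ'.ker := by
    apply Module.lt_rank_of_lt_finrank
    have h1 := LinearMap.finrank_range_add_finrank_ker (Φ' : E →ₗ[ℝ] ℝ)
    have h2 : Module.finrank ℝ (LinearMap.range (Φ' : E →ₗ[ℝ] ℝ)) = 1 := by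
      rw [hsurj]
      simp
    have h3 : Module.finrank ℝ (LinearMap.ker (Φ' : E →ₗ[ℝ] ℝ)) = Module.finrank ℝ Φ'.ker := rfl
    omega
  -- In the implicit function chart the level set is a slice `{0} × ker Φ'`, and the kernel has
  -- dimension at least two.
  set ψ := hΦ.implicitToOpenPartialHomeomorph Φ Φ' hsurj with hψ
  have hψ1 : ∀ x, (ψ x).1 = Φ x := fun x => hΦ.implicitToOpenPartialHomeomorph_fst hsurj x
  have hψa : ψ a = (0, 0) := by
    rw [hψ, hΦ.implicitToOpenPartialHomeomorph_self hsurj, ha]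
  have has : a ∈ ψ.source := hΦ.mem_implicitToOpenPartialHomeomorph_source hsurj
  have hsa : ψ.symm (0, 0) = a := by rw [← hψa, ψ.left_inv has]
  have h0t : ((0 : ℝ), (0 : Φ'.ker)) ∈ ψ.target := hψa ▸ ψ.map_source has
  have hpre : ψ.target ∩ ψ.symm ⁻¹' N ∈ 𝓝 ((0 : ℝ), (0 : Φ'.ker)) := by
    apply inter_mem (ψ.open_target.mem_nhds h0t)
    apply (ψ.continuousAt_symm h0t)
    rwa [hsa]
  obtain ⟨ε, hε, hball⟩ := Metric.mem_nhds_iff.1 hpre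
  refine ⟨ψ.source ∩ ψ ⁻¹' Metric.ball (0, 0) ε, ψ.isOpen_inter_preimage Metric.isOpen_ball,
    ⟨has, ?_⟩, ?_, ?_⟩
  · rw [mem_preimage, hψa]
    exact Metric.mem_ball_self hε
  · rintro x ⟨hxs, hx⟩
    have := (hball hx).2
    rwa [mem_preimage, ψ.left_inv hxs] at this
  · have heq : ((ψ.source ∩ ψ ⁻¹' Metric.ball (0, 0) ε) ∩ {x | Φ x = 0}) \ {a} =
        ψ.symm '' ({0} ×ˢ (Metric.ball (0 : Φ'.ker) ε \ {0})) := by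
      ext x
      constructor
      · rintro ⟨⟨⟨hxs, hx⟩, hx0⟩, hxa⟩
        refine ⟨ψ x, ⟨?_, ?_, ?_⟩, ψ.left_inv hxs⟩
        · rw [mem_singleton_iff, hψ1]
          exact hx0
        · rw [mem_preimage, ← ball_prod_same] at hx
          exact hx.2
        · intro h2
          apply hxa
          have : ψ x = ψ a := by
            rw [hψa]
            exact Prod.ext ((hψ1 x).trans hx0) h2
          exact ψ.injOn hxs has this
      · rintro ⟨⟨r, y⟩, ⟨hr, hy, hy0⟩, rfl⟩
        have hr : r = 0 := hr
        subst hr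
        have hmem : ((0 : ℝ), y) ∈ Metric.ball ((0 : ℝ), (0 : Φ'.ker)) ε := by
          rw [← ball_prod_same]
          exact ⟨Metric.mem_ball_self hε, hy⟩
        have ht := (hball hmem).1
        refine ⟨⟨⟨ψ.map_target ht, ?_⟩, ?_⟩, ?_⟩
        · rw [mem_preimage, ψ.right_inv ht]
          exact hmem
        · rw [mem_ofPred_eq, ← hψ1, ψ.right_inv ht]
        · intro h
          apply hy0
          have h' : ψ (ψ.symm (0, y)) = ψ a := congrArg ψ h
          rw [ψ.right_inv ht, hψa] at h'
          exact congrArg Prod.snd h'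
    rw [heq]
    apply (isConnected_singleton.prod (isConnected_ball_sdiff_center hrank hε)).image
    apply ψ.continuousOn_symm.mono
    rintro ⟨r, y⟩ ⟨hr, hy, -⟩
    apply (hball _).1
    have hr : r = 0 := hr
    rw [hr, ← ball_prod_same]
    exact ⟨Metric.mem_ball_self hε, hy⟩

end LevelSet

/-! ### Topology of the standard surface -/

namespace StandardSurface

variable {g : ℕ}

/-- The projection of the standard surface to the plane. -/
def proj (p : StandardSurface g) : ℂ := ⟨p.1.1, p.1.2.1⟩

/-- The third coordinate on the standard surface. -/
def height (p : StandardSurface g) : ℝ := p.1.2.2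

lemma height_sq (p : StandardSurface g) : height p ^ 2 = discFun g (proj p) := p.2

lemma isEmbedding_coords : IsEmbedding (fun p : StandardSurface g => (p.1 : ℝ × ℝ × ℝ)) :=
  IsEmbedding.subtypeVal

lemma continuous_coords : Continuous (fun p : StandardSurface g => (p.1 : ℝ × ℝ × ℝ)) :=
  isEmbedding_coords.continuous

lemma continuous_height : Continuous (height (g := g)) :=
  (continuous_snd.comp continuous_snd).comp continuous_coords

lemma continuous_proj : Continuous (proj (g := g)) := by
  have h : proj (g := g) = fun p => ((p.1.1 : ℝ) : ℂ) + (p.1.2.1 : ℝ) * Complex.I := by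
    ext p
    apply Complex.ext <;> simp [proj]
  rw [h]
  have h1 : Continuous (fun p : StandardSurface g => p.1.1) := continuous_fst.comp continuous_coords
  have h2 : Continuous (fun p : StandardSurface g => p.1.2.1) :=
    (continuous_fst.comp continuous_snd).comp continuous_coords
  fun_prop

lemma ext {p q : StandardSurface g} (h1 : proj p = proj q) (h2 : height p = height q) : p = q := by
  apply Subtype.ext
  have hre := congrArg Complex.re h1
  have him := congrArg Complex.im h1
  exact Prod.ext hre (Prod.ext him h2)

lemma proj_mem (p : StandardSurface g) : proj p ∈ holedDisc g :=
  mem_holedDisc_of_discFun_nonneg (height_sq p ▸ sq_nonneg _)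

instance : T2Space (StandardSurface g) := isEmbedding_coords.t2Space

/-- The upper (`ε = 1`) and the lower (`ε = -1`) sheet of the standard surface. -/
noncomputable def sheet (ε : ℝ) (hε : ε ^ 2 = 1) (w : holedDisc g) : StandardSurface g :=
  ⟨((w : ℂ).re, (w : ℂ).im, ε * √(discFun g w)), by
    change (ε * √(discFun g w)) ^ 2 = discFun g w
    rw [mul_pow, hε, one_mul, Real.sq_sqrt (discFun_nonneg w.2)]⟩

variable {ε : ℝ} {hε : ε ^ 2 = 1}

@[simp] lemma proj_sheet (w : holedDisc g) : proj (sheet ε hε w) = w := rfl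

@[simp] lemma height_sheet (w : holedDisc g) : height (sheet ε hε w) = ε * √(discFun g w) := rfl

lemma continuous_sheet : Continuous (sheet (g := g) ε hε) := by
  rw [isEmbedding_coords.continuous_iff]
  have h := (continuous_discFun g).comp (continuous_subtype_val (p := (· ∈ holedDisc g)))
  have h' : Continuous fun w : holedDisc g => √(discFun g w) := Real.continuous_sqrt.comp h
  exact (Complex.continuous_re.comp continuous_subtype_val).prodMk
    ((Complex.continuous_im.comp continuous_subtype_val).prodMk (continuous_const.mul h'))

lemma sheet_proj {p : StandardSurface g} (hp : 0 ≤ ε * height p) :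
    sheet ε hε ⟨proj p, proj_mem p⟩ = p := by
  apply ext
  · rfl
  · rw [height_sheet]
    simp only
    have : discFun g (proj p) = (ε * height p) ^ 2 := by rw [mul_pow, hε, one_mul, height_sq]
    rw [this, Real.sqrt_sq hp, ← mul_assoc, ← pow_two, hε, one_mul]

lemma range_sheet_union :
    range (sheet (g := g) 1 (one_pow 2)) ∪ range (sheet (g := g) (-1) (by norm_num)) = univ := by
  rw [eq_univ_iff_forall]
  intro p
  rcases le_total 0 (height p) with h | h
  · exact Or.inl ⟨_, sheet_proj (by linarith)⟩
  · exact Or.inr ⟨_, sheet_proj (by linarith)⟩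

instance : CompactSpace (StandardSurface g) := by
  have := isCompact_iff_compactSpace.1 (isCompact_holedDisc g)
  rw [← isCompact_univ_iff, ← range_sheet_union]
  exact (isCompact_range continuous_sheet).union (isCompact_range continuous_sheet)

/-- The two sheets are images of the connected holed disc and share the point over `outerRadius g`.
-/
instance : PreconnectedSpace (StandardSurface g) := by
  have := isPreconnected_iff_preconnectedSpace.1 (isPreconnected_holedDisc g)
  constructor
  rw [← range_sheet_union]
  have h0 : discFun g (outerRadius g : ℝ) = 0 :=
    discFun_eq_zero_iff.2 (Or.inl (by simp [abs_of_pos (outerRadius_pos g)]))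
  set w : holedDisc g := ⟨(outerRadius g : ℝ), mem_holedDisc_of_discFun_nonneg h0.ge⟩
  refine (isPreconnected_range continuous_sheet).union (sheet 1 (one_pow 2) w) ⟨w, rfl⟩ ⟨w, ?_⟩
    (isPreconnected_range continuous_sheet)
  apply ext
  · rfl
  · simp [w, h0]

/-- The surface is a regular level set in three-space: at nonzero height the vertical derivative is
nonzero, and at height zero the planar derivative in the inward direction is. -/
lemma locallyPuncturedConnected : LocallyPuncturedConnected (StandardSurface g) := by
  intro p N hN
  set Φ : ℝ × ℝ × ℝ → ℝ := fun a => a.2.2 ^ 2 - holedDiscPoly g a.1 a.2.1 with hΦ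
  have hΦc : ContDiff ℝ 1 Φ := by
    simp only [hΦ, holedDiscPoly]
    fun_prop
  have hstrict := hΦc.contDiffAt.hasStrictFDerivAt (x := p.1) one_ne_zero
  have hp0 : Φ p.1 = 0 := sub_eq_zero.2 p.2
  have hne : fderiv ℝ Φ p.1 ≠ 0 := by
    intro h0
    have hline : ∀ v : ℝ × ℝ × ℝ, HasDerivAt (fun t : ℝ => Φ (p.1 + t • v)) 0 0 := by
      intro v
      have h1 : HasDerivAt (fun t : ℝ => p.1 + t • v) v 0 := by
        simpa using ((hasDerivAt_id (0 : ℝ)).smul_const v).const_add p.1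
      have h2 : HasFDerivAt Φ (0 : ℝ × ℝ × ℝ →L[ℝ] ℝ) (p.1 + (0 : ℝ) • v) := by
        rw [zero_smul, add_zero, ← h0]
        exact hstrict.hasFDerivAt
      exact h2.comp_hasDerivAt (0 : ℝ) h1
    by_cases hz : height p = 0
    · obtain ⟨v, d, hd, hv⟩ := exists_hasDerivAt_discFun (g := g) (w := proj p)
        (by rw [← height_sq, hz]; norm_num)
      have h1 : HasDerivAt (fun t : ℝ => Φ (p.1 + t • (v.re, v.im, (0 : ℝ)))) (-d) 0 := by
        refine hv.neg.congr_of_eventuallyEq (Eventually.of_forall fun t => ?_)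
        have hz' : p.1.2.2 = 0 := hz
        simp [hΦ, discFun, proj, hz']
      have := (hline _).unique h1
      linarith
    · have h1 : HasDerivAt (fun t : ℝ => Φ (p.1 + t • ((0 : ℝ), (0 : ℝ), (1 : ℝ))))
          (2 * height p) 0 := by
        have h2 := (((hasDerivAt_id (0 : ℝ)).const_add (height p)).pow 2).sub_const
          (discFun g (proj p))
        refine (h2.congr_deriv (by simp)).congr_of_eventuallyEq (Eventually.of_forall fun t => ?_)
        simp [hΦ, discFun, proj, height]
      have := (hline _).unique h1
      apply hz
      linarith
  obtain ⟨N₀, hN₀, hN₀N⟩ := (isEmbedding_coords.nhds_eq_comap p ▸ hN :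
    N ∈ comap (fun p : StandardSurface g => (p.1 : ℝ × ℝ × ℝ)) (𝓝 p.1))
  obtain ⟨M, hMo, hpM, hMN, hM⟩ := exists_nhds_isConnected_level_sdiff
    (by simp) hstrict hne hp0 hN₀
  refine ⟨(fun p : StandardSurface g => (p.1 : ℝ × ℝ × ℝ)) ⁻¹' M, hMo.preimage continuous_coords,
    hpM, (preimage_mono hMN).trans hN₀N, ?_⟩
  have himage : (fun p : StandardSurface g => (p.1 : ℝ × ℝ × ℝ)) ''
      ((fun p : StandardSurface g => (p.1 : ℝ × ℝ × ℝ)) ⁻¹' M \ {p}) =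
      (M ∩ {x | Φ x = 0}) \ {p.1} := by
    ext a
    constructor
    · rintro ⟨q, ⟨hq, hqp⟩, rfl⟩
      exact ⟨⟨hq, sub_eq_zero.2 q.2⟩, fun h => hqp (Subtype.ext h)⟩
    · rintro ⟨⟨ha, ha0⟩, hap⟩
      exact ⟨⟨a, sub_eq_zero.1 ha0⟩, ⟨ha, fun h => hap (congrArg Subtype.val h)⟩, rfl⟩
  constructor
  · rw [← image_nonempty, himage]
    exact hM.nonempty
  · rw [← isEmbedding_coords.isInducing.isPreconnected_image, himage]
    exact hM.isPreconnected

/-- The points off the plane of symmetry are dense. -/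
lemma exists_height_ne_zero {V : Set (StandardSurface g)} (hV : IsOpen V) (hne : V.Nonempty) :
    ∃ q ∈ V, height q ≠ 0 := by
  obtain ⟨p, hp⟩ := hne
  by_cases hz : height p = 0
  swap
  · exact ⟨p, hp, hz⟩
  obtain ⟨O, hO, rfl⟩ := isEmbedding_coords.isOpen_iff.1 hV
  have hF0 : discFun g (proj p) = 0 := by rw [← height_sq, hz]; norm_num
  obtain ⟨v, d, hd, hv⟩ := exists_hasDerivAt_discFun hF0
  -- Moving inwards from the boundary point makes the defining function positive, so the upper sheet
  -- over this path leaves the plane of symmetry.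
  set path : ℝ → ℝ × ℝ × ℝ := fun t =>
    ((proj p + t * v).re, (proj p + t * v).im, √(discFun g (proj p + t * v))) with hpath
  have hpc : Continuous path := by
    have h1 : Continuous fun t : ℝ => proj p + t * v := by fun_prop
    exact (Complex.continuous_re.comp h1).prodMk ((Complex.continuous_im.comp h1).prodMk
      (Real.continuous_sqrt.comp ((continuous_discFun g).comp h1)))
  have hp0 : path 0 = p.1 := by
    have hz' : p.1.2.2 = 0 := hz
    simp only [hpath, Complex.ofReal_zero, zero_mul, add_zero, hF0, Real.sqrt_zero]
    exact Prod.ext rfl (Prod.ext rfl hz'.symm)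
  have h1 : ∀ᶠ t in 𝓝[>] (0 : ℝ), path t ∈ O :=
    nhdsWithin_le_nhds (hpc.continuousAt.preimage_mem_nhds (hp0 ▸ hO.mem_nhds hp))
  have h2 : ∀ᶠ t : ℝ in 𝓝[>] (0 : ℝ), 0 < discFun g (proj p + t * v) := by
    have h3 := (hasDerivAt_iff_tendsto_slope.1 hv).mono_left
      (nhdsWithin_mono 0 (fun t ht => ne_of_gt ht : Ioi (0 : ℝ) ⊆ {0}ᶜ))
    filter_upwards [h3.eventually (lt_mem_nhds hd), self_mem_nhdsWithin] with t ht ht0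
    have ht0 : 0 < t := ht0
    rw [slope_def_field] at ht
    simp only [Complex.ofReal_zero, zero_mul, add_zero, hF0, sub_zero] at ht
    exact (div_pos_iff_of_pos_right ht0).1 ht
  obtain ⟨t, ht1, ht2⟩ := (h1.and h2).exists
  refine ⟨⟨path t, ?_⟩, ht1, ?_⟩
  · change √(discFun g (proj p + t * v)) ^ 2 = discFun g (proj p + t * v)
    rw [Real.sq_sqrt ht2.le]
  · exact (Real.sqrt_pos.2 ht2).ne'

end StandardSurface

/-! ### Degrees of angle-valued maps on loops -/

section Degree

/-- The angle-valued map `v` of the line is `2π`-periodic, of degree `d`. -/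
def HasDegree (v : ℝ → Real.Angle) (d : ℤ) : Prop :=
  ∃ h : ℝ → ℝ, Continuous h ∧ h (2 * π) = h 0 ∧ ∀ t, v t = d • (t : Real.Angle) + h t

/-- The lift minus the periodic correction and `d t` lift the same angle, so their difference is
constant; over one period only `d t` changes, by `2π d`. -/
lemma HasDegree.eq_zero {v : ℝ → Real.Angle} {d : ℤ} (hv : HasDegree v d) {θ : ℝ → ℝ}
    (hθ : Continuous θ) (hper : θ (2 * π) = θ 0) (h : ∀ t, (θ t : Real.Angle) = v t) : d = 0 := by
  obtain ⟨f, hf, hf0, hvf⟩ := hv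
  have := sub_eq_sub_of_coe_eq (S := univ) isPreconnected_univ (u := fun t => θ t - f t)
    (v := fun t => d * t) (hθ.sub hf).continuousOn (by fun_prop) (c := 0)
    (fun t _ => by simp [h, hvf, ← Real.Angle.intCast_mul_eq_zsmul]) (mem_univ (2 * π))
    (mem_univ 0)
  rw [hper, hf0, mul_zero, sub_zero, sub_eq_self] at this
  have h2 : (d : ℝ) = 0 := by
    rcases mul_eq_zero.1 this with h | h
    · exact h
    · exact absurd h Real.two_pi_pos.ne'
  exact_mod_cast h2

lemma HasDegree.sum {ι : Type*} [Fintype ι] {v : ι → ℝ → Real.Angle} {d : ι → ℤ}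
    (h : ∀ i, HasDegree (v i) (d i)) (n : ι → ℤ) :
    HasDegree (fun t => ∑ i, n i • v i t) (∑ i, n i * d i) := by
  choose f hf hf0 hv using h
  refine ⟨fun t => ∑ i, n i * f i t, by fun_prop, by simp [hf0], fun t => ?_⟩
  have : ((∑ i, n i * f i t : ℝ) : Real.Angle) = ∑ i, n i • (f i t : Real.Angle) := by
    have h1 : ((∑ i, n i * f i t : ℝ) : Real.Angle) =
      Real.Angle.coeHom (∑ i, n i • f i t) := by
      simp only [zsmul_eq_mul]
      rfl
    rw [h1, map_sum]
    exact Finset.sum_congr rfl fun i _ => map_zsmul _ _ _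
  rw [this, Finset.sum_smul, ← Finset.sum_add_distrib]
  exact Finset.sum_congr rfl fun i _ => by rw [hv, smul_add, smul_smul]

lemma hasDegree_zero_of_lift {θ : ℝ → ℝ} (hθ : Continuous θ) (hper : θ (2 * π) = θ 0)
    (c : Real.Angle) : HasDegree (fun t => θ t + c) 0 :=
  ⟨fun t => θ t + c.toReal, by fun_prop, by simp [hper], fun t => by simp⟩

lemma coe_arg_circleExp (t : ℝ) : (Complex.arg (Circle.exp t) : Real.Angle) = t :=
  Real.Angle.arg_toCircle t

/-- A perturbation smaller than `a` keeps `1 + b / a` in the slit plane. Its argument is then a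
genuine real function, so the perturbation does not affect winding. -/
lemma coe_arg_add {a b : ℂ} (h : ‖b‖ < ‖a‖) :
    (Complex.arg (a + b) : Real.Angle) = Complex.arg (1 + b / a) + Complex.arg a := by
  have ha : a ≠ 0 := norm_pos_iff.1 ((norm_nonneg b).trans_lt h)
  have h1 : ‖b / a‖ < 1 := by
    rw [norm_div]
    exact (div_lt_one (norm_pos_iff.2 ha)).2 h
  rw [add_comm (Complex.arg (1 + b / a) : Real.Angle), ← Complex.arg_mul_coe_angle ha
    (Complex.slitPlane_ne_zero (Complex.mem_slitPlane_of_norm_lt_one h1)), mul_add, mul_one,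
    mul_div_cancel₀ _ ha]

lemma continuousAt_arg_one_add_div {Y : Type*} [TopologicalSpace Y] {a b : Y → ℂ} {y : Y}
    (ha : ContinuousAt a y) (hb : ContinuousAt b y) (h : ‖b y‖ < ‖a y‖) :
    ContinuousAt (fun y => Complex.arg (1 + b y / a y)) y := by
  have h0 : a y ≠ 0 := norm_pos_iff.1 ((norm_nonneg _).trans_lt h)
  have h1 : ‖b y / a y‖ < 1 := by
    rw [norm_div]
    exact (div_lt_one (norm_pos_iff.2 h0)).2 h
  exact ContinuousAt.comp (f := fun y => 1 + b y / a y)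
    (Complex.continuousAt_arg (Complex.mem_slitPlane_of_norm_lt_one h1))
    (continuousAt_const.add (hb.div ha h0))

end Degree

/-! ### The `2g` independent classes of the surface -/

namespace StandardSurface

variable {g : ℕ}

/-- The angle of the projection of a point, seen from `c`. -/
noncomputable def angleAbout (c : ℂ) (p : StandardSurface g) : Real.Angle :=
  Complex.arg (proj p - c)

lemma continuousAt_angleAbout {c : ℂ} {p : StandardSurface g} (h : proj p ≠ c) :
    ContinuousAt (angleAbout c) p :=
  ContinuousAt.comp (f := fun p : StandardSurface g => proj p - c)
    (Complex.continuousAt_arg_coe_angle (sub_ne_zero.2 h))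
    (continuous_proj.sub continuous_const).continuousAt

/-- A bump function that is `1` on the boundary of the `k`-th hole and `0` on all other boundary
circles. -/
noncomputable def bump (k : ℕ) (w : ℂ) : ℝ := max 0 (2 - ‖w - holeCenter k‖)

lemma continuous_bump (k : ℕ) : Continuous (bump k) := by
  unfold bump
  fun_prop

lemma bump_eq_zero {k : ℕ} {w : ℂ} (h : 2 ≤ ‖w - holeCenter k‖) : bump k w = 0 :=
  max_eq_left (by linarith)

lemma bump_eq_one {k : ℕ} {w : ℂ} (h : ‖w - holeCenter k‖ = 1) : bump k w = 1 := by
  rw [bump, h]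
  norm_num

lemma bump_eq_zero_of_outer {k : ℕ} (hk : k < g) {w : ℂ} (h : ‖w‖ = outerRadius g) :
    bump k w = 0 := by
  apply bump_eq_zero
  have := le_norm_sub_holeCenter hk w
  linarith

lemma bump_boundary {k : ℕ} (hk : k < g) {w : ℂ} (h : discFun g w = 0) :
    bump k w = 0 ∨ bump k w = 1 := by
  rcases discFun_eq_zero_iff.1 h with h | ⟨j, hj, h⟩
  · exact Or.inl (bump_eq_zero_of_outer hk h)
  · by_cases hjk : k = j
    · subst hjk
      exact Or.inr (bump_eq_one h)
    · left
      apply bump_eq_zero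
      have := le_norm_sub_holeCenter_of_ne hjk w
      linarith

/-- The angle that makes a full turn along the `k`-th tube, from the upper to the lower sheet. -/
noncomputable def tubeAngle (k : ℕ) (p : StandardSurface g) : Real.Angle :=
  if 0 ≤ height p then ((π * bump k (proj p) : ℝ) : Real.Angle)
  else ((-(π * bump k (proj p)) : ℝ) : Real.Angle)

/-- The bump is `0` or `1` on the boundary circles, and `π` and `-π` are the same angle; thus the
half turns on the two sheets join up. -/
lemma tubeAngle_boundary {k : ℕ} (hk : k < g) {p : StandardSurface g} (hp : height p = 0) :
    ((π * bump k (proj p) : ℝ) : Real.Angle) = ((-(π * bump k (proj p)) : ℝ) : Real.Angle) := by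
  have : discFun g (proj p) = 0 := by rw [← height_sq, hp]; norm_num
  rcases bump_boundary hk this with h | h
  · simp [h]
  · rw [h, mul_one, Real.Angle.coe_neg, Real.Angle.neg_coe_pi]

lemma tubeAngle_of_nonneg {k : ℕ} {p : StandardSurface g} (hp : 0 ≤ height p) :
    tubeAngle k p = ((π * bump k (proj p) : ℝ) : Real.Angle) := if_pos hp

lemma tubeAngle_of_nonpos {k : ℕ} (hk : k < g) {p : StandardSurface g} (hp : height p ≤ 0) :
    tubeAngle k p = ((-(π * bump k (proj p)) : ℝ) : Real.Angle) := by
  rcases hp.eq_or_lt with h | h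
  · rw [tubeAngle_of_nonneg h.ge, tubeAngle_boundary hk h]
  · exact if_neg (not_le.2 h)

lemma continuous_tubeAngle {k : ℕ} (hk : k < g) : Continuous (tubeAngle (g := g) k) := by
  have h := (continuous_bump k).comp (continuous_proj (g := g))
  exact Continuous.if_le (Real.Angle.continuous_coe.comp (continuous_const.mul h))
    (Real.Angle.continuous_coe.comp (continuous_const.mul h).neg) continuous_const
    continuous_height fun p hp => tubeAngle_boundary hk hp.symm

lemma continuous_angleAbout_holeCenter {k : ℕ} (hk : k < g) :
    Continuous (angleAbout (g := g) (holeCenter k)) := by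
  rw [continuous_iff_continuousAt]
  intro p
  apply continuousAt_angleAbout
  intro h
  have := (proj_mem p).2 k hk
  rw [h, sub_self, norm_zero] at this
  linarith

/-- The loop around the `j`-th hole. -/
noncomputable def holeLoop {j : ℕ} (hj : j < g) (t : ℝ) : StandardSurface g :=
  sheet 1 (one_pow 2) ⟨holeCenter j + Circle.exp t,
    mem_holedDisc_of_discFun_nonneg (discFun_eq_zero_iff.2 (Or.inr ⟨j, hj, by simp⟩)).ge⟩

lemma continuous_holeLoop {j : ℕ} (hj : j < g) : Continuous (holeLoop hj) :=
  continuous_sheet.comp (by fun_prop)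

lemma proj_holeLoop {j : ℕ} (hj : j < g) (t : ℝ) :
    proj (holeLoop hj t) = holeCenter j + Circle.exp t := rfl

lemma holeLoop_two_pi {j : ℕ} (hj : j < g) : holeLoop hj (2 * π) = holeLoop hj 0 := by
  simp [holeLoop]

lemma hasDegree_angleAbout_holeLoop {j k : ℕ} (hj : j < g) :
    HasDegree (fun t => angleAbout (holeCenter k) (holeLoop hj t)) (if k = j then 1 else 0) := by
  by_cases hkj : k = j
  · subst hkj
    refine ⟨fun _ => 0, continuous_const, rfl, fun t => ?_⟩
    simp only [angleAbout]
    rw [proj_holeLoop, add_sub_cancel_left, coe_arg_circleExp]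
    simp
  · rw [if_neg hkj]
    have hlt : ∀ t : ℝ, ‖(Circle.exp t : ℂ)‖ < ‖holeCenter j - holeCenter k‖ := by
      intro t
      rw [Circle.norm_coe]
      have := three_le_norm_holeCenter_sub (Ne.symm hkj)
      linarith
    have h := hasDegree_zero_of_lift
      (θ := fun t => Complex.arg (1 + (Circle.exp t : ℂ) / (holeCenter j - holeCenter k)))
      (continuous_iff_continuousAt.2 fun t => continuousAt_arg_one_add_div continuousAt_const
        (by fun_prop) (hlt t))
      (by simp) (Complex.arg (holeCenter j - holeCenter k))
    convert h using 2 with t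
    rw [← coe_arg_add (hlt t), angleAbout, proj_holeLoop, add_sub_right_comm]

lemma hasDegree_tubeAngle_holeLoop {j k : ℕ} (hj : j < g) :
    HasDegree (fun t => tubeAngle k (holeLoop hj t)) 0 := by
  have h := hasDegree_zero_of_lift (θ := fun t => π * bump k (proj (holeLoop hj t)))
    (continuous_const.mul ((continuous_bump k).comp
      (continuous_proj.comp (continuous_holeLoop hj))))
    (by simp only [holeLoop_two_pi]) 0
  convert h using 2 with t
  rw [tubeAngle_of_nonneg, add_zero]
  rw [holeLoop, height_sheet]
  positivity

/-- The `2g` standard classes in the first cohomology of the surface. -/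
noncomputable def standardAngle (i : Fin g ⊕ Fin g) : StandardSurface g → Real.Angle :=
  Sum.elim (fun k : Fin g => angleAbout (holeCenter k)) (fun k : Fin g => tubeAngle k) i

lemma continuous_standardAngle (i : Fin g ⊕ Fin g) : Continuous (standardAngle i) := by
  rcases i with k | k
  · exact continuous_angleAbout_holeCenter k.2
  · exact continuous_tubeAngle k.2

/-- Points vertically above the `j`-th hole, up to the outer circle, lie in the holed disc. -/
lemma mem_holedDisc_above {j : ℕ} (hj : j < g) {y : ℝ} (hy : 1 ≤ y)
    (hy' : (3 * j : ℝ) ^ 2 + y ^ 2 ≤ outerRadius g ^ 2) : (⟨3 * j, y⟩ : ℂ) ∈ holedDisc g := by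
  refine mem_holedDisc_of_vertical (y := 1) ?_ (by gcongr) hy'
  apply mem_holedDisc_of_discFun_nonneg (discFun_eq_zero_iff.2 (Or.inr ⟨j, hj, ?_⟩)).ge
  have : (⟨3 * j, 1⟩ : ℂ) - holeCenter j = Complex.I := by
    apply Complex.ext <;> simp [holeCenter]
  rw [this, Complex.norm_I]

/-- The loop around the `j`-th hole has degree one for the angle about that hole and degree zero for
every other class. This removes the first family. The `j`-th tube is then tested on the loop that
runs from hole `j` vertically to the outer circle on one sheet and back on the other. -/
lemma independent_standardAngle : IndependentAngleMaps (standardAngle (g := g)) := by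
  rintro n ⟨θ, hθ, hθn⟩
  have hl : ∀ j : Fin g, n (Sum.inl j) = 0 := by
    intro j
    have h := HasDegree.sum (v := fun i t => standardAngle i (holeLoop j.2 t))
      (d := Sum.elim (fun k : Fin g => if (k : ℕ) = j then 1 else 0) fun _ => 0)
      (by
        rintro (k | k)
        · exact hasDegree_angleAbout_holeLoop j.2
        · exact hasDegree_tubeAngle_holeLoop j.2) n
    have h0 := h.eq_zero (θ := fun t => θ (holeLoop j.2 t)) (hθ.comp (continuous_holeLoop j.2))
      (by simp only [holeLoop_two_pi]) (fun t => hθn _)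
    simpa [Fin.val_inj] using h0
  have hr : ∀ j : Fin g, n (Sum.inr j) = 0 := by
    intro j
    set Y := √(outerRadius g ^ 2 - (3 * j : ℝ) ^ 2) with hY
    have hj1 : ((j : ℕ) : ℝ) + 1 ≤ g := by exact_mod_cast j.2
    have hj0 : (0 : ℝ) ≤ (j : ℕ) := Nat.cast_nonneg _
    have hge : 1 ≤ outerRadius g ^ 2 - (3 * j : ℝ) ^ 2 := by
      unfold outerRadius
      nlinarith
    have hY2 : Y ^ 2 = outerRadius g ^ 2 - (3 * j : ℝ) ^ 2 := Real.sq_sqrt (by linarith)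
    have hY1 : 1 ≤ Y := Real.one_le_sqrt.2 hge
    have hmem : ∀ y : Icc 1 Y, (⟨3 * j, y⟩ : ℂ) ∈ holedDisc g := by
      rintro ⟨y, hy1, hyY⟩
      apply mem_holedDisc_above j.2 hy1
      have := pow_le_pow_left₀ (by linarith : 0 ≤ y) hyY 2
      linarith
    set seg : Icc 1 Y → holedDisc g := fun y => ⟨⟨3 * j, y⟩, hmem y⟩ with hseg
    have hsegc : Continuous seg := by
      apply Continuous.subtype_mk
      have : (fun y : Icc 1 Y => (⟨3 * j, y⟩ : ℂ)) =
          fun y : Icc 1 Y => ((3 * j : ℝ) : ℂ) + ((y : ℝ) : ℂ) * Complex.I := by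
        ext y
        apply Complex.ext <;> simp
      rw [this]
      fun_prop
    set Ψ : Icc 1 Y → ℝ := fun y => ∑ k : Fin g, n (Sum.inr k) * (π * bump k (seg y : ℂ)) with hΨ
    have hΨc : Continuous Ψ := by
      apply continuous_finsetSum
      intro k _
      exact continuous_const.mul (continuous_const.mul ((continuous_bump k).comp
        (continuous_subtype_val.comp hsegc)))
    have hΨcoe : ∀ y, (Ψ y : Real.Angle) =
        ∑ k : Fin g, n (Sum.inr k) • ((π * bump k (seg y : ℂ) : ℝ) : Real.Angle) := by
      intro y
      have h1 : (Ψ y : Real.Angle) =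
        Real.Angle.coeHom (∑ k : Fin g, n (Sum.inr k) • (π * bump k (seg y : ℂ))) := by
        simp only [zsmul_eq_mul, hΨ]
        rfl
      rw [h1, map_sum]
      exact Finset.sum_congr rfl fun i _ => map_zsmul _ _ _
    have : PreconnectedSpace (Icc 1 Y) :=
      isPreconnected_iff_preconnectedSpace.1 isPreconnected_Icc
    set up : Icc 1 Y → StandardSurface g := fun y => sheet 1 (one_pow 2) (seg y)
    set dn : Icc 1 Y → StandardSurface g := fun y => sheet (-1) (by norm_num) (seg y)
    have hup : Continuous fun y => θ (up y) := hθ.comp (continuous_sheet.comp hsegc)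
    have hdn : Continuous fun y => θ (dn y) := hθ.comp (continuous_sheet.comp hsegc)
    have h1 : ∀ y, (θ (up y) : Real.Angle) = Ψ y := by
      intro y
      rw [hθn, hΨcoe, Fintype.sum_sum_type]
      simp only [hl, zero_smul, Finset.sum_const_zero, zero_add]
      refine Finset.sum_congr rfl fun k _ => ?_
      have : standardAngle (Sum.inr k) (up y) = tubeAngle k (up y) := rfl
      rw [this, tubeAngle_of_nonneg (by
        simp only [up, height_sheet]
        positivity)]
      rfl
    have h2 : ∀ y, (θ (dn y) : Real.Angle) = (-Ψ y : ℝ) := by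
      intro y
      rw [hθn, Real.Angle.coe_neg, hΨcoe, Fintype.sum_sum_type, ← Finset.sum_neg_distrib]
      simp only [hl, zero_smul, Finset.sum_const_zero, zero_add]
      refine Finset.sum_congr rfl fun k _ => ?_
      have : standardAngle (Sum.inr k) (dn y) = tubeAngle k (dn y) := rfl
      rw [this, tubeAngle_of_nonpos k.2 (by
        simp only [dn, height_sheet]
        have := Real.sqrt_nonneg (discFun g (seg y))
        linarith), Real.Angle.coe_neg, smul_neg]
      rfl
    set y₁ : Icc 1 Y := ⟨1, le_rfl, hY1⟩ with hy₁
    set y₂ : Icc 1 Y := ⟨Y, hY1, le_rfl⟩ with hy₂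
    have hI : ((seg y₁ : ℂ)) - holeCenter j = Complex.I := by
      apply Complex.ext <;> simp [hseg, hy₁, holeCenter]
    have hn2 : ‖(seg y₂ : ℂ)‖ = outerRadius g := by
      rw [← pow_left_inj₀ (norm_nonneg _) (outerRadius_pos g).le two_ne_zero]
      simp only [hseg, hy₂]
      rw [norm_sq_mk, hY2]
      ring
    have hud : ∀ y, discFun g (seg y) = 0 → up y = dn y := by
      intro y hy
      apply ext
      · rfl
      · simp [up, dn, hy]
    have e1 : up y₁ = dn y₁ :=
      hud _ (discFun_eq_zero_iff.2 (Or.inr ⟨j, j.2, by rw [hI, Complex.norm_I]⟩))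
    have e2 : up y₂ = dn y₂ := hud _ (discFun_eq_zero_iff.2 (Or.inl hn2))
    have hΨ2 : Ψ y₂ = 0 := by
      apply Finset.sum_eq_zero
      intro k _
      rw [bump_eq_zero_of_outer k.2 hn2, mul_zero, mul_zero]
    have hΨ1 : Ψ y₁ = n (Sum.inr j) * π := by
      have hj : bump j (seg y₁ : ℂ) = 1 := bump_eq_one (by rw [hI, Complex.norm_I])
      simp only [hΨ]
      rw [Finset.sum_eq_single j, hj, mul_one]
      · intro k _ hk
        rw [bump_eq_zero, mul_zero, mul_zero]
        have h3 := le_norm_sub_holeCenter_of_ne (j := k) (k := j)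
          (fun h => hk (Fin.ext h)) (seg y₁ : ℂ)
        rw [hI, Complex.norm_I] at h3
        linarith
      · simp
    -- Along the segment `θ - Ψ` is constant on the upper sheet and `θ + Ψ` on the lower one. The
    -- sheets agree at both ends, so the change of `Ψ`, which is `n_j π`, must vanish.
    have c1 := sub_eq_sub_of_coe_eq (S := univ) isPreconnected_univ hup.continuousOn
      hΨc.continuousOn (c := 0) (fun y _ => by simp [h1]) (mem_univ y₁) (mem_univ y₂)
    have c2 := sub_eq_sub_of_coe_eq (S := univ) isPreconnected_univ hdn.continuousOn
      hΨc.neg.continuousOn (c := 0) (fun y _ => by simp [h2]) (mem_univ y₁) (mem_univ y₂)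
    simp only [e1, e2, hΨ1, hΨ2, Pi.neg_apply] at c1 c2
    have h0 : (n (Sum.inr j) : ℝ) * π = 0 := by linarith
    rcases mul_eq_zero.1 h0 with h | h
    · exact_mod_cast h
    · exact absurd h Real.pi_ne_zero
  ext (j | j)
  · exact hl j
  · exact hr j

end StandardSurface

/-- Continuous functions on finitely many disjoint closed sets have a common extension. -/
lemma exists_continuous_eqOn_of_disjoint {X ι : Type*} [TopologicalSpace X] [CompactSpace X]
    [T2Space X] [Finite ι] {C : ι → Set X} (hC : ∀ i, IsClosed (C i))
    (hdisj : ∀ i j x, x ∈ C i → x ∈ C j → i = j) {φ : ι → X → ℝ}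
    (hφ : ∀ i, ContinuousOn (φ i) (C i)) :
    ∃ θ : X → ℝ, Continuous θ ∧ ∀ i, ∀ x ∈ C i, θ x = φ i x := by
  classical
  set θ₀ : X → ℝ := fun x => if h : ∃ i, x ∈ C i then φ h.choose x else 0 with hθ₀
  have heq : ∀ i, ∀ x ∈ C i, θ₀ x = φ i x := by
    intro i x hx
    have h : ∃ i, x ∈ C i := ⟨i, hx⟩
    simp only [hθ₀, dif_pos h]
    rw [hdisj _ _ x h.choose_spec hx]
  have hcont : ContinuousOn θ₀ (⋃ i, C i) :=
    (locallyFinite_of_finite C).continuousOn_iUnion hC fun i =>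
      (hφ i).congr fun x hx => heq i x hx
  obtain ⟨θ, hθ, hθ'⟩ := exists_extension_lift (isClosed_iUnion_of_finite hC) hcont
  exact ⟨θ, hθ, fun i x hx => (hθ' x (mem_iUnion.2 ⟨i, hx⟩)).trans (heq i x hx)⟩

/-! ### Classes that wind about prescribed points -/

namespace StandardSurface

variable {g : ℕ}

/-- The angle about an interior point of the holed disc can be corrected by a real function so that
its values on the boundary circles do not depend on the point. -/
lemma exists_boundary_correction {q : StandardSurface g} (hq : height q ≠ 0) :
    ∃ θ : StandardSurface g → ℝ, Continuous θ ∧ ∀ p, height p = 0 →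
      angleAbout (proj q) p - θ p =
        if ‖proj p‖ = outerRadius g then (Complex.arg (proj p) : Real.Angle) else 0 := by
  have hq0 : discFun g (proj q) ≠ 0 := by
    rw [← height_sq]
    exact pow_ne_zero 2 hq
  have hqR : ‖proj q‖ < outerRadius g :=
    lt_of_le_of_ne (proj_mem q).1 fun h => hq0 (discFun_eq_zero_iff.2 (Or.inl h))
  have hqk : ∀ k < g, 1 < ‖proj q - holeCenter k‖ := fun k hk =>
    lt_of_le_of_ne ((proj_mem q).2 k hk) fun h =>
      hq0 (discFun_eq_zero_iff.2 (Or.inr ⟨k, hk, h.symm⟩))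
  have hkR : ∀ k < g, ∀ w : ℂ, ‖w - holeCenter k‖ = 1 → ‖w‖ ≠ outerRadius g := by
    intro k hk w h1 h2
    have := le_norm_sub_holeCenter hk w
    linarith
  set C : Option (Fin g) → Set (StandardSurface g) := fun i => i.elim
    {p | ‖proj p‖ = outerRadius g} fun k => {p | ‖proj p - holeCenter k‖ = 1} with hC
  -- On the outer circle, `w - q = w (1 - q / w)` leaves `arg w` after correction. On a hole circle,
  -- `q` lies outside the hole, so the whole angle about `q` has a real lift.
  set φ : Option (Fin g) → StandardSurface g → ℝ := fun i => i.elim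
    (fun p => Complex.arg (1 + -proj q / proj p)) fun k p =>
      Complex.arg (1 + (proj p - holeCenter k) / (holeCenter k - proj q)) +
        Complex.arg (holeCenter k - proj q) with hφ
  have hpc := continuous_proj (g := g)
  obtain ⟨θ, hθ, hθC⟩ := exists_continuous_eqOn_of_disjoint (C := C) (φ := φ)
    (by
      rintro (_ | k)
      · exact isClosed_eq hpc.norm continuous_const
      · exact isClosed_eq (hpc.sub continuous_const).norm continuous_const)
    (by
      rintro (_ | j) (_ | k) p h1 h2
      · rfl
      · exact absurd h1 (hkR k k.2 _ h2)
      · exact absurd h2 (hkR j j.2 _ h1)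
      · by_contra hjk
        have h1 : ‖proj p - holeCenter j‖ = 1 := h1
        have h2 : ‖proj p - holeCenter k‖ = 1 := h2
        have := le_norm_sub_holeCenter_of_ne (j := j) (k := k)
          (fun h => hjk (congrArg some (Fin.ext h))) (proj p)
        linarith)
    (by
      rintro (_ | k) p hp
      · have hp : ‖proj p‖ = outerRadius g := hp
        exact (continuousAt_arg_one_add_div hpc.continuousAt continuousAt_const
          (by rwa [norm_neg, hp])).continuousWithinAt
      · have hp : ‖proj p - holeCenter k‖ = 1 := hp
        refine ((continuousAt_arg_one_add_div continuousAt_const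
          (hpc.sub continuous_const).continuousAt ?_).add continuousAt_const).continuousWithinAt
        change ‖proj p - holeCenter k‖ < _
        rw [hp, norm_sub_rev]
        exact hqk k k.2)
  refine ⟨θ, hθ, fun p hp => ?_⟩
  have hp0 : discFun g (proj p) = 0 := by rw [← height_sq, hp]; norm_num
  rcases discFun_eq_zero_iff.1 hp0 with h | ⟨k, hk, h⟩
  · rw [if_pos h, hθC none p h, angleAbout, sub_eq_add_neg (proj p),
      coe_arg_add (by rwa [norm_neg, h])]
    simp [hφ]
  · rw [if_neg (hkR k hk _ h), hθC (some ⟨k, hk⟩) p h, angleAbout]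
    have e : proj p - proj q = (holeCenter k - proj q) + (proj p - holeCenter k) := by ring
    rw [e, coe_arg_add (by rw [h, norm_sub_rev]; exact hqk k hk)]
    simp [hφ]

lemma proj_ne_proj {ε : ℝ} (hε : ε ^ 2 = 1) {p q : StandardSurface g} (hpq : p ≠ q)
    (hp : 0 ≤ ε * height p) (hq : 0 ≤ ε * height q) : proj p ≠ proj q := by
  intro h
  apply hpq
  rw [← sheet_proj (hε := hε) hp, ← sheet_proj (hε := hε) hq]
  congr 1
  exact Subtype.ext h

lemma exists_sign {q : StandardSurface g} (hq : height q ≠ 0) :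
    ∃ ε : ℝ, ε ^ 2 = 1 ∧ 0 < ε * height q := by
  rcases lt_or_gt_of_ne hq with h | h
  · exact ⟨-1, by norm_num, by linarith⟩
  · exact ⟨1, by norm_num, by linarith⟩

/-- A map that is, up to a continuous summand, a nonzero multiple of the angle about `q` is
essential at `q`. -/
lemma essentialAt_of_eventuallyEq {q : StandardSurface g} (hq : height q ≠ 0)
    {f s' : StandardSurface g → Real.Angle} {m : ℤ} (hm : m ≠ 0) (hs' : ContinuousAt s' q)
    (hf : ∀ᶠ x in 𝓝 q, f x = m • angleAbout (proj q) x + s' x) : EssentialAt f q := by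
  intro n s hs L hL
  set S : StandardSurface g → Real.Angle := fun x => n • s' x + s x with hS
  have hSc : ContinuousAt S q := (hs'.zsmul n).add hs
  obtain ⟨ε, hε, hεq⟩ := exists_sign hq
  have hproj : ∀ᶠ x in 𝓝[≠] q, proj x ≠ proj q := by
    have h1 : ∀ᶠ x in 𝓝 q, 0 < ε * height x :=
      (continuous_const.mul continuous_height).continuousAt.eventually (lt_mem_nhds hεq)
    filter_upwards [self_mem_nhdsWithin, mem_nhdsWithin_of_mem_nhds h1] with x hx1 hx2
    exact proj_ne_proj hε hx1 hx2.le hεq.le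
  have hLS : ∀ᶠ x in 𝓝[≠] q, ContinuousAt L x ∧
      (L x : Real.Angle) = (n * m) • angleAbout (proj q) x + S x := by
    filter_upwards [hL, mem_nhdsWithin_of_mem_nhds hf] with x ⟨hx1, hx2⟩ hx3
    refine ⟨hx1, ?_⟩
    rw [hx2, hx3, hS, smul_add, smul_smul, add_assoc]
  -- The map `s` is assumed continuous only at `q`; nearby, continuity of `S` follows by solving the
  -- relation for it.
  have hSx : ∀ᶠ x in 𝓝[≠] q, ContinuousAt S x := by
    filter_upwards [eventually_eventually_nhdsWithin.2 hLS, hproj, hLS, self_mem_nhdsWithin]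
      with x hx1 hx2 hx3 hx4
    rw [isOpen_compl_singleton.nhdsWithin_eq hx4] at hx1
    have hc : ContinuousAt (fun y => (L y : Real.Angle) - (n * m) • angleAbout (proj q) y) x :=
      (Real.Angle.continuous_coe.continuousAt.comp hx3.1).sub
        ((continuousAt_angleAbout hx2).zsmul _)
    refine hc.congr ?_
    filter_upwards [hx1] with y hy
    rw [hy.2, add_sub_cancel_left]
  have hSπ : ∀ᶠ x in 𝓝 q, S x - S q ≠ π := by
    have h1 : ContinuousAt (fun x => S x - S q) q := hSc.sub continuousAt_const
    refine h1.eventually_ne ?_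
    rw [sub_self]
    exact Real.Angle.pi_ne_zero.symm
  have hgood := hLS.and (hSx.and (eventually_nhdsWithin_of_eventually_nhds hSπ))
  rw [eventually_nhdsWithin_iff] at hgood
  have hq0 : 0 < discFun g (proj q) := by
    rw [← height_sq]
    positivity
  have hD : holedDisc g ∈ 𝓝 (proj q) := by
    filter_upwards [(continuous_discFun g).continuousAt.eventually (lt_mem_nhds hq0)] with w hw
    exact mem_holedDisc_of_discFun_nonneg hw.le
  set w₀ : holedDisc g := ⟨proj q, proj_mem q⟩
  have hw₀ : sheet ε hε w₀ = q := sheet_proj hεq.le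
  have htend : Tendsto (sheet ε hε) (𝓝 w₀) (𝓝 q) := by
    have := (continuous_sheet (ε := ε) (hε := hε)).tendsto w₀
    rwa [hw₀] at this
  have hgood' := htend.eventually hgood
  obtain ⟨δ₁, hδ₁, h1⟩ := Metric.eventually_nhds_iff.1 hgood'
  obtain ⟨δ₂, hδ₂, h2⟩ := Metric.mem_nhds_iff.1 hD
  obtain ⟨ρ, hρ, hρδ⟩ := exists_between (lt_min hδ₁ hδ₂)
  have hdist : ∀ t : ℝ, dist (proj q + ρ * Circle.exp t) (proj q) = ρ := by
    intro t
    simp [abs_of_pos hρ]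
  have hmem : ∀ t : ℝ, proj q + ρ * Circle.exp t ∈ holedDisc g := by
    intro t
    apply h2
    rw [Metric.mem_ball, hdist]
    exact hρδ.trans_le (min_le_right _ _)
  set γ : ℝ → StandardSurface g := fun t => sheet ε hε ⟨_, hmem t⟩ with hγ
  have hγc : Continuous γ := continuous_sheet.comp (by fun_prop)
  have hγq : ∀ t, γ t ≠ q := by
    intro t h
    have h3 := hdist t
    have h4 : proj q + ρ * Circle.exp t = proj q := congrArg proj h
    rw [h4, dist_self] at h3
    exact hρ.ne h3
  have hγg : ∀ t, (ContinuousAt L (γ t) ∧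
      (L (γ t) : Real.Angle) = (n * m) • angleAbout (proj q) (γ t) + S (γ t)) ∧
      ContinuousAt S (γ t) ∧ S (γ t) - S q ≠ π := fun t => h1 (y := ⟨_, hmem t⟩) (by
    rw [Subtype.dist_eq, hdist]
    exact hρδ.trans_le (min_le_left _ _)) (hγq t)
  have hper : γ (2 * π) = γ 0 := by simp [hγ]
  -- On a small circle about `q` the angle has degree one, while `S - S q` avoids `π` and
  -- contributes a periodic real function. Having the real lift `L`, the sum has degree zero, so `n
  -- * m = 0`.
  have hdeg : HasDegree (fun t => (L (γ t) : Real.Angle)) (n * m) := by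
    refine ⟨fun t => (S (γ t) - S q).toReal + (S q).toReal, ?_, by simp only [hper], fun t => ?_⟩
    · refine Continuous.add (continuous_iff_continuousAt.2 fun t => ?_) continuous_const
      have hc : ContinuousAt (fun t => S (γ t) - S q) t :=
        (ContinuousAt.comp (g := S) (hγg t).2.1 hγc.continuousAt).sub continuousAt_const
      exact ContinuousAt.comp (f := fun t => S (γ t) - S q) (continuousAt_toReal (hγg t).2.2) hc
    · have ha : angleAbout (proj q) (γ t) = t := by
        rw [angleAbout, hγ, proj_sheet]
        simp only [add_sub_cancel_left]
        rw [Complex.arg_real_mul _ hρ, coe_arg_circleExp]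
      simp only
      rw [(hγg t).1.2, ← ha]
      simp
  have h0 := hdeg.eq_zero (θ := fun t => L (γ t))
    (continuous_iff_continuousAt.2 fun t =>
      ContinuousAt.comp (g := L) (hγg t).1.1 hγc.continuousAt)
    (by simp only [hper]) fun t => rfl
  exact (mul_eq_zero.1 h0).resolve_right hm

/-- For distinct points `q`, `q₀` off the plane of symmetry there is an angle-valued map that is
continuous except at `q` and `q₀`, and essential at `q`. -/
lemma exists_essentialAt {q q₀ : StandardSurface g} (hq : height q ≠ 0) (hq₀ : height q₀ ≠ 0)
    (hne : q ≠ q₀) :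
    ∃ f : StandardSurface g → Real.Angle, (∀ x, x ≠ q → x ≠ q₀ → ContinuousAt f x) ∧
      EssentialAt f q := by
  obtain ⟨θ, hθ, hθb⟩ := exists_boundary_correction hq
  obtain ⟨θ₀, hθ₀, hθ₀b⟩ := exists_boundary_correction hq₀
  -- The pair `m, m₀` is used on the upper sheet, `n, n₀` on the lower one. Both corrected angles
  -- have the same boundary values, so equal sums make the sheets match. A coefficient vanishes on
  -- the sheet not containing its point, where the angle would be singular at the mirror image; the
  -- coefficient of `q` on its own sheet is nonzero.
  obtain ⟨m, m₀, n, n₀, hsum, hm, hn, hm₀, hn₀, hmq, hnq⟩ : ∃ m m₀ n n₀ : ℤ, m + m₀ = n + n₀ ∧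
      (height q < 0 → m = 0) ∧ (0 < height q → n = 0) ∧ (height q₀ < 0 → m₀ = 0) ∧
      (0 < height q₀ → n₀ = 0) ∧ (0 < height q → m ≠ 0) ∧ (height q < 0 → n ≠ 0) := by
    rcases lt_or_gt_of_ne hq with h | h <;> rcases lt_or_gt_of_ne hq₀ with h₀ | h₀
    · exact ⟨0, 0, 1, -1, by norm_num, by simp, by simp [h.le], by simp, by simp [h₀.le],
        by simp [h.le], by simp⟩
    · exact ⟨0, 1, 1, 0, by norm_num, by simp, by simp [h.le], by simp [h₀.le], by simp,
        by simp [h.le], by simp⟩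
    · exact ⟨1, 0, 0, 1, by norm_num, by simp [h.le], by simp, by simp, by simp [h₀.le],
        by simp, by simp [h.le]⟩
    · exact ⟨1, -1, 0, 0, by norm_num, by simp [h.le], by simp, by simp [h₀.le], by simp,
        by simp, by simp [h.le]⟩
  set T : StandardSurface g → Real.Angle := fun x => angleAbout (proj q) x - θ x with hT
  set T₀ : StandardSurface g → Real.Angle := fun x => angleAbout (proj q₀) x - θ₀ x with hT₀
  have hTc : ∀ (q : StandardSurface g) (θ : StandardSurface g → ℝ), Continuous θ →
      ∀ (ε : ℝ), ε ^ 2 = 1 → ∀ k : ℤ, (ε * height q < 0 → k = 0) → ∀ x, x ≠ q →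
      0 ≤ ε * height x →
      ContinuousAt (fun x => k • (angleAbout (proj q) x - (θ x : Real.Angle))) x := by
    intro q θ hθ ε hε k hk x hxq hx
    by_cases hk0 : k = 0
    · simp only [hk0, zero_smul]
      exact continuousAt_const
    · have hεq : 0 ≤ ε * height q := not_lt.1 fun h => hk0 (hk h)
      exact ((continuousAt_angleAbout (proj_ne_proj hε hxq hx hεq)).sub
        (Real.Angle.continuous_coe.comp hθ).continuousAt).zsmul k
  have hTup : ∀ x, x ≠ q → 0 ≤ height x → ContinuousAt (fun x => m • T x) x := fun x hxq hx =>
    hTc q θ hθ 1 (by norm_num) m (by simpa using hm) x hxq (by simpa using hx)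
  have hTdn : ∀ x, x ≠ q → height x ≤ 0 → ContinuousAt (fun x => n • T x) x := fun x hxq hx =>
    hTc q θ hθ (-1) (by norm_num) n (by simpa using hn) x hxq (by simpa using hx)
  have hT₀up : ∀ x, x ≠ q₀ → 0 ≤ height x → ContinuousAt (fun x => m₀ • T₀ x) x := fun x hxq hx =>
    hTc q₀ θ₀ hθ₀ 1 (by norm_num) m₀ (by simpa using hm₀) x hxq (by simpa using hx)
  have hT₀dn : ∀ x, x ≠ q₀ → height x ≤ 0 → ContinuousAt (fun x => n₀ • T₀ x) x := fun x hxq hx =>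
    hTc q₀ θ₀ hθ₀ (-1) (by norm_num) n₀ (by simpa using hn₀) x hxq (by simpa using hx)
  set f : StandardSurface g → Real.Angle := fun x =>
    if 0 ≤ height x then m • T x + m₀ • T₀ x else n • T x + n₀ • T₀ x with hf
  have hfup : ∀ x, 0 < height x → ∀ᶠ y in 𝓝 x, f y = m • T y + m₀ • T₀ y := by
    intro x hx
    filter_upwards [continuous_height.continuousAt.eventually (lt_mem_nhds hx)] with y hy
    exact if_pos hy.le
  have hfdn : ∀ x, height x < 0 → ∀ᶠ y in 𝓝 x, f y = n • T y + n₀ • T₀ y := by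
    intro x hx
    filter_upwards [continuous_height.continuousAt.eventually (gt_mem_nhds hx)] with y hy
    exact if_neg (not_le.2 hy)
  refine ⟨f, fun x hxq hxq₀ => ?_, ?_⟩
  · rcases lt_trichotomy (height x) 0 with h | h | h
    · exact ((hTdn x hxq h.le).add (hT₀dn x hxq₀ h.le)).congr
        ((hfdn x h).mono fun y hy => hy.symm)
    · have hu : f x = m • T x + m₀ • T₀ x := if_pos h.ge
      have hd : f x = n • T x + n₀ • T₀ x := by
        rw [hu]
        simp only [hT, hT₀]
        rw [hθb x h, hθ₀b x h, ← add_smul, ← add_smul, hsum]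
      have h1 : ContinuousAt (fun x => m • T x + m₀ • T₀ x) x :=
        (hTup x hxq h.ge).add (hT₀up x hxq₀ h.ge)
      have h2 : ContinuousAt (fun x => n • T x + n₀ • T₀ x) x :=
        (hTdn x hxq h.le).add (hT₀dn x hxq₀ h.le)
      rw [ContinuousAt, ← hu] at h1
      rw [ContinuousAt, ← hd] at h2
      exact Tendsto.if' h1 h2
    · exact ((hTup x hxq h.le).add (hT₀up x hxq₀ h.le)).congr
        ((hfup x h).mono fun y hy => hy.symm)
  · have hθc : ∀ k : ℤ, ContinuousAt (fun x => -(k • (θ x : Real.Angle))) q := fun k =>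
      ((Real.Angle.continuous_coe.comp hθ).continuousAt.zsmul k).neg
    rcases lt_or_gt_of_ne hq with h | h
    · refine essentialAt_of_eventuallyEq hq (hnq h) ((hθc n).add (hT₀dn q hne h.le)) ?_
      filter_upwards [hfdn q h] with x hx
      rw [hx, hT, smul_sub, sub_eq_add_neg, add_assoc]
      rfl
    · refine essentialAt_of_eventuallyEq hq (hmq h) ((hθc m).add (hT₀up q hne h.le)) ?_
      filter_upwards [hfup q h] with x hx
      rw [hx, hT, smul_sub, sub_eq_add_neg, add_assoc]
      rfl

end StandardSurface

/-! ### Transfer along homeomorphisms and the final count -/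

section Transfer

variable {X Y : Type*} [TopologicalSpace X] [TopologicalSpace Y]

lemma LocallyPuncturedConnected.of_homeomorph (e : X ≃ₜ Y) (h : LocallyPuncturedConnected Y) :
    LocallyPuncturedConnected X := by
  intro p N hN
  obtain ⟨M, hMo, hpM, hMN, hM⟩ := h (e p) (e.symm ⁻¹' N)
    (e.symm.continuous.continuousAt.preimage_mem_nhds (by simpa using hN))
  refine ⟨e ⁻¹' M, hMo.preimage e.continuous, hpM, fun x hx => by simpa using hMN hx, ?_⟩
  have : e ⁻¹' M \ {p} = e.symm '' (M \ {e p}) := by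
    rw [e.symm.image_eq_preimage_symm]
    ext x
    simp
  rw [this]
  exact hM.image _ e.symm.continuous.continuousOn

lemma IndependentAngleMaps.comp_homeomorph {ι : Type*} [Fintype ι] {u : ι → Y → Real.Angle}
    (h : IndependentAngleMaps u) (e : X ≃ₜ Y) : IndependentAngleMaps fun i => u i ∘ e := by
  rintro n ⟨θ, hθ, hθn⟩
  exact h n ⟨θ ∘ e.symm, hθ.comp e.symm.continuous, fun y => by simp [hθn]⟩

lemma EssentialAt.comp_homeomorph {f : Y → Real.Angle} (e : X ≃ₜ Y) {q : X}
    (h : EssentialAt f (e q)) : EssentialAt (f ∘ e) q := by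
  intro n s hs L hL
  have hsym : Tendsto e.symm (𝓝[≠] (e q)) (𝓝[≠] q) := by
    apply tendsto_nhdsWithin_of_tendsto_nhds_of_eventually_within
    · have := e.symm.continuous.tendsto (e q)
      rw [e.symm_apply_apply] at this
      exact this.mono_left nhdsWithin_le_nhds
    · filter_upwards [self_mem_nhdsWithin] with y hy h
      apply hy
      rw [← e.apply_symm_apply y, h]
      rfl
  refine h n (s ∘ e.symm) ?_ (L ∘ e.symm) ?_
  · exact ContinuousAt.comp (by rwa [e.symm_apply_apply]) e.symm.continuous.continuousAt
  · filter_upwards [hsym.eventually hL] with y hy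
    exact ⟨ContinuousAt.comp hy.1 e.symm.continuous.continuousAt, by simpa using hy.2⟩

end Transfer

/-- On a surface of genus `g` with the finite set `P` of punctures, two simple closed curves whose
complementary components are discs and once-punctured discs meet in at least `2g - 2 + |P|`
points. -/
theorem two_mul_genus_add_card_le {g : ℕ} {X : Type*} [TopologicalSpace X]
    (hX : IsClosedSurfaceOfGenus g X) {P : Finset X} {α β : SimpleClosedCurve (Punctured P)}
    (hfin : (α.image ∩ β.image).Finite)
    (hfill : ∀ x ∈ (α.image ∪ β.image)ᶜ,
      IsOpenDisc (connectedComponentIn (α.image ∪ β.image)ᶜ x) ∨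
      IsOncePuncturedDisc (connectedComponentIn (α.image ∪ β.image)ᶜ x)) :
    2 * g + P.card ≤ (α.image ∩ β.image).ncard + 2 := by
  obtain ⟨e⟩ := hX
  have : CompactSpace X := e.symm.compactSpace
  have : T2Space X := e.symm.t2Space
  have : PreconnectedSpace X := e.symm.surjective.denseRange.preconnectedSpace e.symm.continuous
  have hloc : LocallyPuncturedConnected X :=
    StandardSurface.locallyPuncturedConnected.of_homeomorph e
  have := hloc.locallyConnectedSpace
  set a : Circle → X := fun c => (α.map c : X) with ha
  set b : Circle → X := fun c => (β.map c : X) with hb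
  have hac : Continuous a := continuous_subtype_val.comp α.map.continuous
  have hbc : Continuous b := continuous_subtype_val.comp β.map.continuous
  have hai : Function.Injective a := Subtype.val_injective.comp α.injective
  have hbi : Function.Injective b := Subtype.val_injective.comp β.injective
  have hra : range a = Subtype.val '' α.image := range_comp _ _
  have hrb : range b = Subtype.val '' β.image := range_comp _ _
  have hG : range a ∪ range b = Subtype.val '' (α.image ∪ β.image) := by
    rw [hra, hrb, image_union]
  have hI : range a ∩ range b = Subtype.val '' (α.image ∩ β.image) := by
    rw [hra, hrb, image_inter Subtype.val_injective]
  have hGc : IsClosed (range a ∪ range b) :=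
    (isCompact_range hac).isClosed.union (isCompact_range hbc).isClosed
  have hcomp : ∀ x ∈ (range a ∪ range b)ᶜ,
      IsOpenDisc (connectedComponentIn (range a ∪ range b)ᶜ x) ∧
      (connectedComponentIn (range a ∪ range b)ᶜ x ∩ P).Subsingleton := by
    intro x hx
    rw [hG] at hx hGc ⊢
    exact isOpenDisc_component_of_punctured hloc ((range_nonempty _).inl) hGc hfill hx
  have hPG : ∀ p ∈ P, p ∈ (range a ∪ range b)ᶜ := by
    intro p hp
    rw [hG]
    rintro ⟨z, -, rfl⟩
    exact z.2 hp
  set C : X → Set X := connectedComponentIn (range a ∪ range b)ᶜ with hC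
  -- Each puncture is replaced by a point of the same component off the plane of symmetry, where the
  -- explicit classes are available. Only the component containing it matters for the count.
  have hq : ∀ p ∈ P, ∃ q ∈ C p, StandardSurface.height (e q) ≠ 0 := by
    intro p hp
    obtain ⟨y, hy, hy0⟩ := StandardSurface.exists_height_ne_zero (V := e.symm ⁻¹' C p)
      ((hGc.isOpen_compl.connectedComponentIn).preimage e.symm.continuous)
      ⟨e p, by
        rw [mem_preimage, e.symm_apply_apply]
        exact mem_connectedComponentIn (hPG p hp)⟩
    exact ⟨e.symm y, hy, by simpa using hy0⟩
  choose! q hqC hqh using hq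
  have hCq : ∀ p ∈ P, C (q p) = C p := fun p hp => (connectedComponentIn_eq (hqC p hp)).symm
  have hCinj : ∀ p ∈ P, ∀ p' ∈ P, C p = C p' → p = p' := by
    intro p hp p' hp' h
    exact (hcomp p (hPG p hp)).2 ⟨mem_connectedComponentIn (hPG p hp), hp⟩
      ⟨(h ▸ mem_connectedComponentIn (hPG p' hp') : p' ∈ C p), hp'⟩
  have hqinj : ∀ p ∈ P, ∀ p' ∈ P, q p = q p' → p = p' := by
    intro p hp p' hp' h
    apply hCinj p hp p' hp'
    rw [← hCq p hp, h, hCq p' hp']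
  have hQG : ∀ x ∈ q '' P, x ∉ range a ∪ range b := by
    rintro _ ⟨p, hp, rfl⟩
    exact connectedComponentIn_subset _ _ (hqC p hp)
  have hsub : ∀ x ∈ (range a ∪ range b)ᶜ, (C x ∩ q '' P).Subsingleton := by
    rintro x - _ ⟨h1, p, hp, rfl⟩ _ ⟨h2, p', hp', rfl⟩
    have e1 : C x = C (q p) := connectedComponentIn_eq h1
    have e2 : C x = C (q p') := connectedComponentIn_eq h2
    rw [hCinj p hp p' hp' (by rw [← hCq p hp, ← e1, e2, hCq p' hp'])]
  have hQf : (q '' P).Finite := P.finite_toSet.image q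
  have hncard : (range a ∩ range b).ncard = (α.image ∩ β.image).ncard := by
    rw [hI, ncard_image_of_injective _ Subtype.val_injective]
  have hfin' : (range a ∩ range b).Finite := hI ▸ hfin.image _
  have hcount : ∀ (J : Type _) [Fintype J] (r : J → X) (f : J → X → Real.Angle),
      (∀ j, ContinuousOn (f j) (q '' P)ᶜ) → (∀ i j, i ≠ j → ContinuousAt (f j) (r i)) →
      (∀ j, EssentialAt (f j) (r j)) →
      2 * g + Fintype.card J ≤ (α.image ∩ β.image).ncard + 1 := by
    intro J _ r f h1 h2 h3
    have := card_add_card_le hac hbc hai hbi hfin' hQf hQG (fun x hx => (hcomp x hx).1) hsub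
      (u := fun i => StandardSurface.standardAngle i ∘ e)
      (fun i => (StandardSurface.continuous_standardAngle i).comp e.continuous)
      (StandardSurface.independent_standardAngle.comp_homeomorph e) h1 h2 h3
    rw [hncard, Fintype.card_sum, Fintype.card_fin] at this
    omega
  rcases P.eq_empty_or_nonempty with rfl | ⟨p₀, hp₀⟩
  · have := hcount PEmpty nofun nofun nofun nofun nofun
    simp at this ⊢
    omega
  · classical
    -- One puncture serves as the common second singularity of all these maps, which leaves `n - 1`
    -- classes.
    have hf : ∀ j : P.erase p₀, ∃ f : StandardSurface g → Real.Angle,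
        (∀ x, x ≠ e (q j) → x ≠ e (q p₀) → ContinuousAt f x) ∧ EssentialAt f (e (q j)) := by
      rintro ⟨p, hp⟩
      obtain ⟨hp1, hp2⟩ := Finset.mem_erase.1 hp
      exact StandardSurface.exists_essentialAt (hqh p hp2) (hqh p₀ hp₀)
        fun h => hp1 (hqinj p hp2 p₀ hp₀ (e.injective h))
    choose f hfc hfe using hf
    have hfc' : ∀ (j : P.erase p₀) (x : X), x ≠ q j → x ≠ q p₀ → ContinuousAt (f j ∘ e) x :=
      fun j x h1 h2 => ContinuousAt.comp (hfc j (e x) (e.injective.ne h1) (e.injective.ne h2))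
        e.continuous.continuousAt
    have hP : ∀ j : P.erase p₀, (j : X) ∈ P := fun j => Finset.mem_of_mem_erase j.2
    have := hcount (P.erase p₀) (fun j => q j) (fun j => f j ∘ e)
      (fun j x hx => (hfc' j x (fun h => hx ⟨j, hP j, h.symm⟩)
        (fun h => hx ⟨p₀, hp₀, h.symm⟩)).continuousWithinAt)
      (fun i j hij => hfc' j (q i) (fun h => hij (Subtype.ext (hqinj i (hP i) j (hP j) h)))
        (fun h => Finset.ne_of_mem_erase i.2 (hqinj i (hP i) p₀ hp₀ h)))
      (fun j => (hfe j).comp_homeomorph e)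
    rw [Fintype.card_coe, Finset.card_erase_of_mem hp₀] at this
    have := Finset.card_pos.2 ⟨p₀, hp₀⟩
    omega

end FillingCurves

theorem lemma2 (g n : ℕ) {X : Type*} [TopologicalSpace X]
    (hX : FillingCurves.IsClosedSurfaceOfGenus g X) (P : Finset X) (hP : P.card = n)
    (α β : FillingCurves.SimpleClosedCurve (FillingCurves.Punctured P))
    (hfill : FillingCurves.Fill α β) :
    ((-FillingCurves.eulerChar g n).toNat : ℕ∞) ≤ FillingCurves.intersectionNumber α β := by
  obtain ⟨α', β', -, -, hmin, hcomp⟩ := hfill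
  rw [← hmin]
  by_cases hfin : (α'.image ∩ β'.image).Finite
  · have h := FillingCurves.two_mul_genus_add_card_le hX hfin hcomp
    rw [← hfin.cast_ncard_eq, Nat.cast_le, FillingCurves.eulerChar]
    omega
  -- An infinite intersection counts as `⊤`, and the bound is trivial.
  · rw [Set.Infinite.encard_eq hfin]
    exact le_top
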